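/- Let $K=\mathrm{SU}(2)$, $U=K\times K$, and for $t\in\mathbb R$ put $m_t=\mathrm{diag}(e^{it/2},e^{-it/2})$, $a_t=(m_t,m_{-t})$, $A_*=\{a_t:0\le t<4\pi\}$ and $A_*'=\{a_t\in A_*:t\notin\pi\mathbb Z\}$. For $\ell\in\frac12\mathbb N$ let $H^\ell$ be the space of homogeneous polynomials of degree $2\ell$ in $x,y$, with orthonormal basis $\psi^\ell_j=\binom{2\ell}{\ell-j}^{1/2}x^{\ell-j}y^{\ell+j}$ ($j=-\ell,-\ell+1,\dots,\ell$) and the $K$-action $T^\ell(k)p=p\circ k^{t}$. Let $C^{\ell_1,\ell_2,\ell}_{j_1,j_2,j}$ be the Clebsch–Gordan coefficients of $\mathrm{SU}(2)$ in the standard normalization (zero outside their range of admissible indices), let $\beta:H^\ell\to H^{\ell_1}\otimes H^{\ell_2}$ be the linear map $\psi^\ell_j\mapsto\sum_{j_1,j_2}C^{\ell_1,\ell_2,\ell}_{j_1,j_2,j}\,\psi^{\ell_1}_{j_1}\otimes\psi^{\ell_2}_{j_2}$, and let $\Phi^\ell_{\ell_1,\ell_2}(k_1,k_2)=\beta^*\circ(T^{\ell_1}(k_1)\otimes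 T^{\ell_2}(k_2))\circ\beta\in\mathrm{End}(H^\ell)$ be the spherical function of type $\ell$. Write $\varphi=\Phi^0_{1/2,1/2}:U\to\mathrm{End}(H^0)=\mathbb C$. Fix $\ell\in\frac12\mathbb N$. For $d\in\mathbb N=\{0,1,2,\dots\}$ and $k\in\{-\ell,-\ell+1,\dots,\ell\}$ put $\zeta(d,k)=\left(\frac{d+\ell+k}2,\frac{d+\ell-k}2\right)$. The full spherical function of type $\ell$ and degree $d$ is the matrix function on $A_*$ with entries, for $p,q\in\{-\ell,\dots,\ell\}$, $$\left(\Phi^\ell_d(a)\right)_{p,q}=\left(\Phi^\ell_{\zeta(d,p)}(a)\right)_{q,q}$$ (diagonal entries with respect to the basis $\psi^\ell$), and $Q^\ell_d=\Phi^\ell_d(\Phi^\ell_0)^{-1}$ on $A_*'$. Let $$a^{(\ell_1,\ell_2)}_{(m_1,m_2),\ell}=\sum C^{\ell_1,\ell_2,\ell}_{j_1,j_2,\ell}\,C^{\frac12,\frac12,0}_{i_1,i_2,0}\,C^{\ell_1,\frac12,m_1}_{j_1,i_1,n_1}\,C^{\ell_2,\frac12,m_2}_{j_2,i_2,n_2}\,C^{m_1,m_2,\ell}_{n_1,n_2,\ell},$$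 the sum being over all weights $|j_1|\le\ell_1$, $|j_2|\le\ell_2$, $|i_1|,|i_2|\le\frac12$, $|n_1|\le m_1$, $|n_2|\le m_2$. With $E_{k,k'}$ the elementary matrices ($E_{k,k'}=0$ if $|k|>\ell$ or $|k'|>\ell$) define $$A_d=\sum_{k=-\ell}^{\ell}\left|a^{\zeta(d,k)}_{\zeta(d+1,k),\ell}\right|^2E_{k,k},\qquad C_d=\sum_{k=-\ell}^{\ell}\left|a^{\zeta(d,k)}_{\zeta(d-1,k),\ell}\right|^2E_{k,k}\quad(d\ge1),\qquad C_0=0,$$ $$B_d=\sum_{k=-\ell}^{\ell}\left(\left|a^{\zeta(d,k)}_{\zeta(d,k+1),\ell}\right|^2E_{k,k+1}+\left|a^{\zeta(d,k)}_{\zeta(d,k-1),\ell}\right|^2E_{k,k-1}\right),$$ and put $\Phi^\ell_{-1}=Q^\ell_{-1}=0$. Then: 1. For all $d\in\mathbb N$ and $a\in A_*$, $\;\varphi(a)\,\Phi^\ell_d(a)=A_d\Phi^\ell_{d+1}(a)+B_d\Phi^\ell_d(a)+C_d\Phi^\ell_{d-1}(a)$. 2. For $a\in A_*'$ the matrix $\Phi^\ell_0(a)$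 is invertible, and for all $d\in\mathbb N$, $\;\varphi(a)\,Q^\ell_d(a)=A_dQ^\ell_{d+1}(a)+B_dQ^\ell_d(a)+C_dQ^\ell_{d-1}(a)$. Moreover there are matrix polynomials $P_d$ in one variable with $Q^\ell_d(a)=P_d(\varphi(a))$ for all $a\in A_*'$, $d\in\mathbb N$, and the recurrence in 2 holds at every $a\in A_*$ if $Q^\ell_d(a)$ is read as $P_d(\varphi(a))$. 3. $A_d\in\mathrm{GL}_{2\ell+1}(\mathbb R)$ for all $d\in\mathbb N$. -/

import Mathlib

open scoped TensorProduct

noncomputable section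

namespace SU2

/-! Conventions.  A spin `ℓ ∈ ½ℕ` is encoded by the natural number `n = 2ℓ`, and a weight
`j ∈ {-ℓ, -ℓ+1, …, ℓ}` by the index `i = ℓ + j ∈ {0, …, n}`, an element of `Fin (n + 1)`. -/

/-- The group `K = SU(2)`. -/
abbrev K : Type := Matrix.specialUnitaryGroup (Fin 2) ℂ

/-- The group `U = K × K`. -/
abbrev U : Type := K × K

/-- The space `H^ℓ` (`n = 2ℓ`) of homogeneous polynomials of degree `2ℓ` in the two variables
`x = X 0`, `y = X 1`. -/
abbrev H (n : ℕ) : Type := MvPolynomial.homogeneousSubmodule (Fin 2) ℂ n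

/-- The exponent vector of the monomial `x ^ (n - i) * y ^ i`. -/
def expo (n i : ℕ) : Fin 2 →₀ ℕ := Finsupp.single 0 (n - i) + Finsupp.single 1 i

theorem expo_degree {n i : ℕ} (hi : i ≤ n) : (expo n i).degree = n := by
  rw [expo, map_add, Finsupp.degree_single, Finsupp.degree_single]; omega

theorem eq_expo {n : ℕ} {e : Fin 2 →₀ ℕ} (he : e.degree = n) : e = expo n (e 1) := by
  have h : e 0 + e 1 = n := by
    rw [← he, Finsupp.degree_eq_sum, Fin.sum_univ_two]
  ext j
  fin_cases j
  · simp [expo]; omega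
  · simp [expo]

/-- The standard weight vector `ψ^ℓ_j = binom(2ℓ, ℓ-j)^{1/2} x^{ℓ-j} y^{ℓ+j}`, where `i = ℓ + j`
(note `binom(2ℓ, ℓ-j) = binom(2ℓ, ℓ+j)`). -/
def psi (n : ℕ) (i : Fin (n + 1)) : H n :=
  ⟨MvPolynomial.monomial (expo n i) ((Real.sqrt (n.choose i) : ℝ) : ℂ), by
    rw [MvPolynomial.mem_homogeneousSubmodule]
    exact MvPolynomial.isHomogeneous_monomial _ (expo_degree (Nat.lt_succ_iff.mp i.2))⟩

/-- The Hermitian inner product on `H^ℓ` for which the vectors `psi n i` form an orthonormal basis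
(conjugate linear in the first variable, as everywhere in Mathlib). -/
@[reducible] def innerCore (n : ℕ) : InnerProductSpace.Core ℂ (H n) where
  inner p q := ∑ i : Fin (n + 1), (starRingEnd ℂ) (p.1.coeff (expo n i)) * q.1.coeff (expo n i)
    / ((n.choose i : ℕ) : ℂ)
  conj_inner_symm p q := by
    simp only [map_sum, map_div₀, map_mul, Complex.conj_conj, Complex.conj_natCast]
    exact Finset.sum_congr rfl fun i _ => by ring
  re_inner_nonneg p := by
    rw [map_sum]
    refine Finset.sum_nonneg fun i _ => ?_
    rw [← Complex.normSq_eq_conj_mul_self]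
    have : ((Complex.normSq (p.1.coeff (expo n i)) : ℝ) : ℂ) / ((n.choose i : ℕ) : ℂ)
        = ((Complex.normSq (p.1.coeff (expo n i)) / (n.choose i : ℕ) : ℝ) : ℂ) := by
      push_cast; rfl
    rw [this]
    exact div_nonneg (Complex.normSq_nonneg _) (Nat.cast_nonneg _)
  add_left p q r := by
    rw [← Finset.sum_add_distrib]
    refine Finset.sum_congr rfl fun i _ => ?_
    simp only [Submodule.coe_add, MvPolynomial.coeff_add, map_add]
    ring
  smul_left p q c := by
    rw [Finset.mul_sum]
    refine Finset.sum_congr rfl fun i _ => ?_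
    simp only [Submodule.coe_smul, MvPolynomial.coeff_smul, smul_eq_mul, map_mul]
    ring
  definite p hp := by
    have key : ∀ i : Fin (n + 1), (starRingEnd ℂ) (p.1.coeff (expo n i)) * p.1.coeff (expo n i)
        / ((n.choose i : ℕ) : ℂ)
        = ((Complex.normSq (p.1.coeff (expo n i)) / (n.choose i : ℕ) : ℝ) : ℂ) := by
      intro i
      rw [← Complex.normSq_eq_conj_mul_self]; push_cast; rfl
    have hp' : ∑ i : Fin (n + 1), Complex.normSq (p.1.coeff (expo n i)) / (n.choose i : ℕ)
        = 0 := by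
      have h : ∑ i : Fin (n + 1), (starRingEnd ℂ) (p.1.coeff (expo n i)) * p.1.coeff (expo n i)
        / ((n.choose i : ℕ) : ℂ) = 0 := hp
      simp only [key] at h
      exact_mod_cast h
    rw [Finset.sum_eq_zero_iff_of_nonneg
      (fun i _ => div_nonneg (Complex.normSq_nonneg _) (Nat.cast_nonneg _))] at hp'
    ext e
    simp only [ZeroMemClass.coe_zero, MvPolynomial.coeff_zero]
    by_contra hne
    have hdeg : e.degree = n := by
      have h := (MvPolynomial.mem_homogeneousSubmodule n p.1).mp p.2 hne
      rw [Finsupp.degree_eq_weight_one]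
      exact h
    have he := eq_expo hdeg
    have hle : e 1 ≤ n := by
      rw [← hdeg]; exact Finsupp.le_degree 1 e
    have h0 := hp' ⟨e 1, Nat.lt_succ_iff.mpr hle⟩ (Finset.mem_univ _)
    have hc : ((n.choose (e 1) : ℕ) : ℝ) ≠ 0 := by
      exact_mod_cast (Nat.choose_pos hle).ne'
    rw [div_eq_zero_iff] at h0
    rcases h0 with h0 | h0
    · rw [Complex.normSq_eq_zero] at h0
      exact hne (he ▸ h0)
    · exact hc h0

instance (n : ℕ) : NormedAddCommGroup (H n) :=
  @InnerProductSpace.Core.toNormedAddCommGroup ℂ (H n) _ _ _ (innerCore n)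

instance (n : ℕ) : InnerProductSpace ℂ (H n) :=
  InnerProductSpace.ofCore (innerCore n).toCore

theorem inner_psi (n : ℕ) (i : Fin (n + 1)) (p : H n) :
    inner ℂ (psi n i) p = p.1.coeff (expo n i) / ((Real.sqrt (n.choose i) : ℝ) : ℂ) := by
  have hc : (0 : ℝ) < n.choose i := by exact_mod_cast Nat.choose_pos (Nat.lt_succ_iff.mp i.2)
  have hs : ((Real.sqrt (n.choose i) : ℝ) : ℂ) ≠ 0 := by
    exact_mod_cast (Real.sqrt_pos.mpr hc).ne'
  have hsq : ((n.choose i : ℕ) : ℂ)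
      = ((Real.sqrt (n.choose i) : ℝ) : ℂ) * ((Real.sqrt (n.choose i) : ℝ) : ℂ) := by
    rw [← Complex.ofReal_mul, Real.mul_self_sqrt hc.le]; simp
  change ∑ j : Fin (n + 1), (starRingEnd ℂ) ((psi n i).1.coeff (expo n j)) * p.1.coeff (expo n j)
    / ((n.choose j : ℕ) : ℂ) = _
  rw [Finset.sum_eq_single i]
  · simp only [psi, MvPolynomial.coeff_monomial, if_true, Complex.conj_ofReal]
    rw [hsq]
    field_simp
  · intro j _ hj
    have : expo n i ≠ expo n j := fun h => hj (Fin.ext (by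
      have := DFunLike.congr_fun h 1
      simpa [expo] using this.symm))
    simp [psi, MvPolynomial.coeff_monomial, this]
  · simp

theorem orthonormal_psi (n : ℕ) : Orthonormal ℂ (psi n) := by
  rw [orthonormal_iff_ite]
  intro i j
  have hc : (0 : ℝ) < n.choose i := by exact_mod_cast Nat.choose_pos (Nat.lt_succ_iff.mp i.2)
  have hs : ((Real.sqrt (n.choose i) : ℝ) : ℂ) ≠ 0 := by
    exact_mod_cast (Real.sqrt_pos.mpr hc).ne'
  rw [inner_psi]
  split_ifs with h
  · subst h
    simp only [psi, MvPolynomial.coeff_monomial, if_true]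
    exact div_self hs
  · have : expo n j ≠ expo n i := fun h' => h (Fin.ext (by
      have := DFunLike.congr_fun h' 1
      simpa [expo] using this.symm))
    simp [psi, MvPolynomial.coeff_monomial, this]

instance (n : ℕ) : FiniteDimensional ℂ (H n) :=
  Module.Finite.of_injective
    (LinearMap.pi fun i : Fin (n + 1) => (innerₛₗ ℂ (psi n i) : H n →ₗ[ℂ] ℂ)) (by
      rw [← LinearMap.ker_eq_bot, LinearMap.ker_eq_bot']
      intro p hp
      refine (innerCore n).definite p (Finset.sum_eq_zero fun i _ => ?_)
      have h : inner ℂ (psi n i) p = 0 := congrFun hp i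
      have hc : (0 : ℝ) < n.choose i := by exact_mod_cast Nat.choose_pos (Nat.lt_succ_iff.mp i.2)
      have hs : ((Real.sqrt (n.choose i) : ℝ) : ℂ) ≠ 0 := by
        exact_mod_cast (Real.sqrt_pos.mpr hc).ne'
      rw [inner_psi, div_eq_zero_iff, or_iff_left hs] at h
      simp [h])

/-- Substitution `p ↦ p ∘ kᵗ` on polynomials in two variables. -/
def subst (k : K) : MvPolynomial (Fin 2) ℂ →ₐ[ℂ] MvPolynomial (Fin 2) ℂ :=
  MvPolynomial.aeval fun i => ∑ j : Fin 2, MvPolynomial.C (k.1.transpose i j) * MvPolynomial.X j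

theorem subst_mem (k : K) (n : ℕ) (p : MvPolynomial (Fin 2) ℂ)
    (hp : p ∈ MvPolynomial.homogeneousSubmodule (Fin 2) ℂ n) :
    (subst k).toLinearMap p ∈ MvPolynomial.homogeneousSubmodule (Fin 2) ℂ n := by
  rw [MvPolynomial.mem_homogeneousSubmodule] at hp ⊢
  have h := hp.aeval (n := 1)
    (fun i => ∑ j : Fin 2, MvPolynomial.C (k.1.transpose i j) * MvPolynomial.X j)
    (fun i => MvPolynomial.IsHomogeneous.sum _ _ _ fun j _ =>
      MvPolynomial.isHomogeneous_C_mul_X _ j)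
  simpa [subst] using h

/-- The representation `T^ℓ` (`n = 2ℓ`) of `K` on `H^ℓ`, `T^ℓ(k) p = p ∘ kᵗ`. -/
def T (n : ℕ) (k : K) : H n →ₗ[ℂ] H n :=
  (subst k).toLinearMap.restrict (subst_mem k n)

/-- The outer tensor product representation `T^{ℓ₁,ℓ₂}` of `U` on `H^{ℓ₁} ⊗ H^{ℓ₂}`. -/
def TT (n₁ n₂ : ℕ) (x : U) : H n₁ ⊗[ℂ] H n₂ →ₗ[ℂ] H n₁ ⊗[ℂ] H n₂ :=
  TensorProduct.map (T n₁ x.1) (T n₂ x.2)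

/-- The Clebsch–Gordan coefficient `C^{ℓ₁,ℓ₂,ℓ}_{j₁,j₂,j}` of `SU(2)` in the standard
(Condon–Shortley) normalization, by van der Waerden's formula; `n₁ = 2ℓ₁`, `n₂ = 2ℓ₂`, `n = 2ℓ`,
`i₁ = ℓ₁ + j₁`, `i₂ = ℓ₂ + j₂`, `i = ℓ + j`.  It vanishes unless `|ℓ₁ - ℓ₂| ≤ ℓ ≤ ℓ₁ + ℓ₂`,
`ℓ₁ + ℓ₂ - ℓ ∈ ℤ`, `|j₁| ≤ ℓ₁`, `|j₂| ≤ ℓ₂`, `|j| ≤ ℓ` and `j₁ + j₂ = j`; under these conditions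
all subtractions and all divisions by two below are exact, e.g.
`(n₁ + n₂ - n) / 2 = ℓ₁ + ℓ₂ - ℓ`, and `n₁ - i₁ = ℓ₁ - j₁`. -/
def clebschGordan (n₁ n₂ n i₁ i₂ i : ℕ) : ℝ :=
  if n ≤ n₁ + n₂ ∧ n₁ ≤ n + n₂ ∧ n₂ ≤ n + n₁ ∧ Even (n₁ + n₂ + n) ∧
      i₁ ≤ n₁ ∧ i₂ ≤ n₂ ∧ i ≤ n ∧ 2 * (i₁ + i₂) + n = 2 * i + n₁ + n₂ then
    Real.sqrt (((n + 1 : ℕ) : ℝ) * ((n + n₁ - n₂) / 2).factorial * ((n + n₂ - n₁) / 2).factorial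
        * ((n₁ + n₂ - n) / 2).factorial / ((n₁ + n₂ + n) / 2 + 1).factorial)
      * Real.sqrt ((i.factorial : ℝ) * (n - i).factorial * i₁.factorial * (n₁ - i₁).factorial
        * i₂.factorial * (n₂ - i₂).factorial)
      * ∑ k ∈ (Finset.range ((n₁ + n₂ - n) / 2 + 1)).filter fun k =>
          k ≤ n₁ - i₁ ∧ k ≤ i₂ ∧ (n₁ + n₂ - n) / 2 ≤ i₁ + k ∧ (n₁ + n₂ - n) / 2 ≤ n₂ - i₂ + k,
        (-1 : ℝ) ^ k / ((k.factorial : ℝ) * ((n₁ + n₂ - n) / 2 - k).factorial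
          * (n₁ - i₁ - k).factorial * (i₂ - k).factorial
          * (i₁ + k - (n₁ + n₂ - n) / 2).factorial
          * (n₂ - i₂ + k - (n₁ + n₂ - n) / 2).factorial)
  else 0

/-- The vector `φ^{ℓ₁,ℓ₂}_{ℓ,j} = ∑_{j₁,j₂} C^{ℓ₁,ℓ₂,ℓ}_{j₁,j₂,j} ψ^{ℓ₁}_{j₁} ⊗ ψ^{ℓ₂}_{j₂}`. -/
def cgVector (n₁ n₂ n : ℕ) (i : Fin (n + 1)) : H n₁ ⊗[ℂ] H n₂ :=
  ∑ i₁ : Fin (n₁ + 1), ∑ i₂ : Fin (n₂ + 1),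
    ((clebschGordan n₁ n₂ n i₁ i₂ i : ℝ) : ℂ) • (psi n₁ i₁ ⊗ₜ[ℂ] psi n₂ i₂)

/-- The linear map `β^{ℓ₁,ℓ₂}_ℓ : H^ℓ → H^{ℓ₁} ⊗ H^{ℓ₂}` with `ψ^ℓ_j ↦ φ^{ℓ₁,ℓ₂}_{ℓ,j}`. -/
def beta (n₁ n₂ n : ℕ) : H n →ₗ[ℂ] H n₁ ⊗[ℂ] H n₂ :=
  ∑ i : Fin (n + 1), (innerₛₗ ℂ (psi n i)).smulRight (cgVector n₁ n₂ n i)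

theorem beta_psi (n₁ n₂ n : ℕ) (i : Fin (n + 1)) :
    beta n₁ n₂ n (psi n i) = cgVector n₁ n₂ n i := by
  simp [beta, LinearMap.sum_apply, orthonormal_iff_ite.mp (orthonormal_psi n)]

/-- The spherical function `Φ^ℓ_{ℓ₁,ℓ₂}(x) = β^* ∘ T^{ℓ₁,ℓ₂}(x) ∘ β ∈ End(H^ℓ)` of type `ℓ`;
here `n = 2ℓ` and `l = (2ℓ₁, 2ℓ₂)`. -/
def spherical (n : ℕ) (l : ℕ × ℕ) (x : U) : H n →ₗ[ℂ] H n :=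
  LinearMap.adjoint (beta l.1 l.2 n) ∘ₗ TT l.1 l.2 x ∘ₗ beta l.1 l.2 n

/-- The zonal spherical function `φ = Φ^0_{1/2,1/2} : U → End(H^0) = ℂ`
(`H^0` is spanned by the unit vector `psi 0 0`). -/
def zonal (x : U) : ℂ := inner ℂ (psi 0 0) (spherical 0 (1, 1) x (psi 0 0))

/-- `m_t = k(e^{it/2}, 0) ∈ K`. -/
def m (t : ℝ) : K :=
  ⟨!![Complex.exp (Complex.I * t / 2), 0;
      0, (starRingEnd ℂ) (Complex.exp (Complex.I * t / 2))], by
    have h : Complex.exp (Complex.I * t / 2)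
        * (starRingEnd ℂ) (Complex.exp (Complex.I * t / 2)) = 1 := by
      rw [← Complex.exp_conj, ← Complex.exp_add]
      have h2 : (starRingEnd ℂ) (2 : ℂ) = 2 := Complex.conj_ofNat 2
      simp [neg_div, h2]
    rw [Matrix.mem_specialUnitaryGroup_iff, Matrix.mem_unitaryGroup_iff]
    refine ⟨?_, by rw [Matrix.det_fin_two_of]; simpa using h⟩
    ext i j
    fin_cases i <;> fin_cases j <;>
      simp [Matrix.mul_apply, Fin.sum_univ_two, Matrix.star_apply, h, mul_comm _ (Complex.exp _)]⟩

/-- `a_t = (m_t, m_{-t}) ∈ U`. -/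
def torusElt (t : ℝ) : U := (m t, m (-t))

/-- `A_* = {a_t : 0 ≤ t < 4π}`. -/
def Astar : Set U := {a | ∃ t : ℝ, 0 ≤ t ∧ t < 4 * Real.pi ∧ a = torusElt t}

/-- The regular part `A_*' = {a_t ∈ A_* : t ∉ πℤ}` of `A_*`. -/
def AstarReg : Set U :=
  {a | ∃ t : ℝ, 0 ≤ t ∧ t < 4 * Real.pi ∧ (∀ z : ℤ, t ≠ z * Real.pi) ∧ a = torusElt t}

/-- `ζ(d,k) = ((d+ℓ+k)/2, (d+ℓ-k)/2)`, with both entries doubled and `p = ℓ + k`. -/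
def zeta (n d : ℕ) (p : Fin (n + 1)) : ℕ × ℕ := (d + p, d + (n - p))

/-- The full spherical function `Φ_d^ℓ` (`n = 2ℓ`) of type `ℓ` and degree `d`: its `(p,q)` entry
is the `q`-th diagonal entry of `Φ^ℓ_{ζ(d,p)}` in the basis `ψ^ℓ`. -/
def fullSpherical (n d : ℕ) (a : U) : Matrix (Fin (n + 1)) (Fin (n + 1)) ℂ :=
  Matrix.of fun p q => inner ℂ (psi n q) (spherical n (zeta n d p) a (psi n q))

/-- The full spherical polynomial `Q_d^ℓ = Φ_d^ℓ (Φ_0^ℓ)⁻¹`, as a function of the group element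
(meaningful where `Φ_0^ℓ` is invertible, in particular on `A_*'`). -/
def fullSphericalPoly (n d : ℕ) (a : U) : Matrix (Fin (n + 1)) (Fin (n + 1)) ℂ :=
  fullSpherical n d a * (fullSpherical n 0 a)⁻¹

/-- The coefficient `a^{(ℓ₁,ℓ₂)}_{(m₁,m₂),ℓ}`, where `n = 2ℓ`, `l = (2ℓ₁, 2ℓ₂)`,
`r = (2m₁, 2m₂)`:
`∑ C^{ℓ₁,ℓ₂,ℓ}_{j₁,j₂,ℓ} C^{½,½,0}_{i₁,i₂,0} C^{ℓ₁,½,m₁}_{j₁,i₁,n₁} C^{ℓ₂,½,m₂}_{j₂,i₂,n₂}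
C^{m₁,m₂,ℓ}_{n₁,n₂,ℓ}`. -/
def recCoeff (n : ℕ) (l r : ℕ × ℕ) : ℝ :=
  ∑ j₁ : Fin (l.1 + 1), ∑ j₂ : Fin (l.2 + 1), ∑ i₁ : Fin 2, ∑ i₂ : Fin 2,
    ∑ n₁ : Fin (r.1 + 1), ∑ n₂ : Fin (r.2 + 1),
      clebschGordan l.1 l.2 n j₁ j₂ n * clebschGordan 1 1 0 i₁ i₂ 0
        * clebschGordan l.1 1 r.1 j₁ i₁ n₁ * clebschGordan l.2 1 r.2 j₂ i₂ n₂
        * clebschGordan r.1 r.2 n n₁ n₂ n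

/-- `A_d = ∑_k |a^{ζ(d,k)}_{ζ(d+1,k),ℓ}|² E_{k,k}`. -/
def recA (n d : ℕ) : Matrix (Fin (n + 1)) (Fin (n + 1)) ℝ :=
  ∑ k, Matrix.single k k (|recCoeff n (zeta n d k) (zeta n (d + 1) k)| ^ 2)

/-- `B_d = ∑_k (|a^{ζ(d,k)}_{ζ(d,k+1),ℓ}|² E_{k,k+1} + |a^{ζ(d,k)}_{ζ(d,k-1),ℓ}|² E_{k,k-1})`,
where elementary matrices with an index outside `{-ℓ, …, ℓ}` are zero. -/
def recB (n d : ℕ) : Matrix (Fin (n + 1)) (Fin (n + 1)) ℝ :=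
  ∑ k : Fin (n + 1), ∑ k' : Fin (n + 1), if (k' : ℕ) = k + 1 ∨ (k : ℕ) = k' + 1 then
    Matrix.single k k' (|recCoeff n (zeta n d k) (zeta n d k')| ^ 2) else 0

/-- `C_d = ∑_k |a^{ζ(d,k)}_{ζ(d-1,k),ℓ}|² E_{k,k}` for `d ≥ 1`, and `C_0 = 0` (no pair of the form
`ζ(-1,k)` contains the type `ℓ`). -/
def recC (n : ℕ) : ℕ → Matrix (Fin (n + 1)) (Fin (n + 1)) ℝ
  | 0 => 0
  | d + 1 => ∑ k, Matrix.single k k (|recCoeff n (zeta n (d + 1) k) (zeta n d k)| ^ 2)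

/-- A real matrix, regarded as a complex one. -/
def toC {n : ℕ} (M : Matrix (Fin (n + 1)) (Fin (n + 1)) ℝ) :
    Matrix (Fin (n + 1)) (Fin (n + 1)) ℂ := M.map Complex.ofReal

/-- `F_{-1} = 0`, and `F_{d-1}` for `d ≥ 1`. -/
def prev {n : ℕ} (F : ℕ → Matrix (Fin (n + 1)) (Fin (n + 1)) ℂ) :
    ℕ → Matrix (Fin (n + 1)) (Fin (n + 1)) ℂ
  | 0 => 0
  | d + 1 => F d

end SU2

end

/-!
Write a triple of spins as `(ℓ₁, ℓ₂, ℓ) = ((a + b) / 2, (a + c) / 2, (b + c) / 2)`; the degree `d`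
and the index `p` of `ζ(d, k)` are then `a = d`, `b = p`, `c = n - p`.  Van der Waerden's formula
expresses the Clebsch–Gordan coefficient through the coefficients `wSum a b c` of
`(y₁ x₂ - x₁ y₂) ^ a (x₁ u + y₁ v) ^ b (x₂ u + y₂ v) ^ c`.

The recurrence expresses the decomposition of `(H^{ℓ₁} ⊗ H^{ℓ₂}) ⊗ (H^{1/2} ⊗ H^{1/2})` under
`SU(2) × SU(2)` into the four components of spins `(ℓ₁ ± 1/2, ℓ₂ ± 1/2)`.  By Schur's lemma the
projection of `β^{ℓ₁,ℓ₂}_ℓ ⊗ β^{½,½}_0` to a component is a multiple `κ` of the Clebsch–Gordan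
embedding of that component.  Here this is proved without representation theory: multiplying the
generating polynomial by `y₁ x₂ - x₁ y₂`, polarizing it in either direction and applying Cayley's
operator to it give the four contiguous relations `wSum_sub_wSum`, `wSum_polarize_right`,
`wSum_polarize_left` and `wSum_cayley`, which exhibit `κ` explicitly (`coupling_zero_zero` and its
companions).  As the highest weight vector is normed (`sum_clebschGordan_top_sq`, a Vandermonde
convolution), `κ` equals the coefficient `recCoeff` up to the norming factors (`recCoeff_eq`).

On the torus a diagonal entry of a spherical function is the sum of the squared Clebsch–Gordan
coefficients against characters (`inner_spherical`), and `φ(a_t) = cos t`.  So the recurrence is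
Parseval's identity for the four components (`parseval_coupling`), weight by weight, summed against
a character (`cos_mul_diagEntry`).

For `A_d` the multiple is `κ = a + 1`, which is not zero; hence `A_d` is invertible and the
recurrence generates the polynomials `P_d`.  The rows of `Φ₀` are given by the coefficients of
`(1 + e^{-it} w) ^ p (1 + e^{it} w) ^ (n - p)`, which are linearly independent as soon as
`e^{it} ≠ e^{-it}` (`isUnit_fullSpherical_zero`).
-/

noncomputable section

namespace SU2

/-! ### Contiguous relations for van der Waerden sums -/

/-- The reciprocal factorial `1 / z!` on the integers, extended by `0` to `z < 0`. -/
def invFact (z : ℤ) : ℝ := if 0 ≤ z then ((z.toNat.factorial : ℕ) : ℝ)⁻¹ else 0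

theorem invFact_neg {z : ℤ} (h : z < 0) : invFact z = 0 := if_neg (by omega)

theorem invFact_natCast (k : ℕ) : invFact k = ((k.factorial : ℕ) : ℝ)⁻¹ := by
  simp [invFact]

theorem mul_invFact (z : ℤ) : (z : ℝ) * invFact z = invFact (z - 1) := by
  rcases lt_trichotomy z 0 with h | h | h
  · rw [invFact_neg h, invFact_neg (by omega), mul_zero]
  · subst h; rw [invFact_neg (z := 0 - 1) (by norm_num)]; simp
  · obtain ⟨k, rfl⟩ : ∃ k : ℕ, z = k + 1 := ⟨(z - 1).toNat, by omega⟩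
    have : ((k : ℤ) + 1) = ((k + 1 : ℕ) : ℤ) := by push_cast; rfl
    rw [add_sub_cancel_right, this, invFact_natCast, invFact_natCast, Nat.factorial_succ]
    push_cast
    have h1 : (k : ℝ) + 1 ≠ 0 := by positivity
    have h2 : ((k.factorial : ℕ) : ℝ) ≠ 0 := by positivity
    field_simp

/-- The `k`-th term of van der Waerden's sum, for spins `(a + b) / 2`, `(a + c) / 2` and
`(b + c) / 2`. -/
def wTerm (a b c i₁ i₂ k : ℤ) : ℝ :=
  (-1) ^ k.toNat * (invFact k * invFact (a - k) * invFact (a + b - i₁ - k) * invFact (i₂ - k)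
    * invFact (i₁ + k - a) * invFact (c - i₂ + k))

/-- Van der Waerden's sum, the Clebsch–Gordan coefficient without its norming factors.
For `a, b, c ≥ 0`, multiplied by `a! b! c!` it is the coefficient of
`x₁ ^ (a + b - i₁) y₁ ^ i₁ x₂ ^ (a + c - i₂) y₂ ^ i₂` in
`(y₁ x₂ - x₁ y₂) ^ a (x₁ u + y₁ v) ^ b (x₂ u + y₂ v) ^ c` at `u = v = 1`.
With integer parameters it vanishes outside the admissible range by itself. -/
def wSum (a b c i₁ i₂ : ℤ) : ℝ :=
  ∑ k ∈ Finset.range (a + 1).toNat, wTerm a b c i₁ i₂ k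

theorem wTerm_eq_zero {a b c i₁ i₂ k : ℤ} (h : k < 0 ∨ a < k ∨ a + b - i₁ < k ∨ i₂ < k ∨
    i₁ + k < a ∨ c + k < i₂) : wTerm a b c i₁ i₂ k = 0 := by
  unfold wTerm
  rcases h with h | h | h | h | h | h
  · simp [invFact_neg h]
  · simp [invFact_neg (show a - k < 0 by omega)]
  · simp [invFact_neg (show a + b - i₁ - k < 0 by omega)]
  · simp [invFact_neg (show i₂ - k < 0 by omega)]
  · simp [invFact_neg (show i₁ + k - a < 0 by omega)]
  · simp [invFact_neg (show c - i₂ + k < 0 by omega)]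

theorem wSum_eq_range (a b c i₁ i₂ : ℤ) {L : ℕ} (hL : a < L) :
    wSum a b c i₁ i₂ = ∑ k ∈ Finset.range L, wTerm a b c i₁ i₂ k := by
  refine Finset.sum_subset (fun k hk => ?_) (fun k _ hk => ?_)
  · simp only [Finset.mem_range] at hk ⊢; omega
  · simp only [Finset.mem_range] at hk
    exact wTerm_eq_zero (by omega)

theorem wSum_eq_zero {a b c i₁ i₂ : ℤ} (h : a < 0 ∨ b < 0 ∨ c < 0 ∨ i₁ < 0 ∨ i₂ < 0 ∨
    a + b < i₁ ∨ a + c < i₂) : wSum a b c i₁ i₂ = 0 := by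
  refine Finset.sum_eq_zero fun k hk => wTerm_eq_zero ?_
  simp only [Finset.mem_range] at hk
  omega

/-- Creative telescoping for van der Waerden sums: a summand of the form `Z (k + 1) - Z k`
sums to zero when `Z` vanishes at both ends. -/
theorem sum_eq_zero_of_telescope (f Z : ℤ → ℝ) (L : ℕ) (h0 : Z 0 = 0) (hL : Z L = 0)
    (h : ∀ k : ℕ, f k = Z (k + 1) - Z k) : ∑ k ∈ Finset.range L, f k = 0 := by
  have := Finset.sum_range_sub (fun k : ℕ => Z k) L
  simp only [Nat.cast_succ, Nat.cast_zero, h0, hL, sub_zero] at this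
  rw [← this]
  exact Finset.sum_congr rfl fun k _ => h k

theorem wTerm_natCast {a b c i₁ i₂ : ℤ} {k : ℕ} (B C D E F : ℤ) (hB : a - k = B)
    (hC : a + b - i₁ - k = C) (hD : i₂ - k = D) (hE : i₁ + k - a = E) (hF : c - i₂ + k = F) :
    wTerm a b c i₁ i₂ k = (-1) ^ k * (invFact k * invFact B * invFact C * invFact D
      * invFact E * invFact F) := by
  subst hB hC hD hE hF; rfl

theorem wTerm_natCast_succ {a b c i₁ i₂ : ℤ} {k : ℕ} (B C D E F : ℤ) (hB : a - (k + 1) = B)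
    (hC : a + b - i₁ - (k + 1) = C) (hD : i₂ - (k + 1) = D) (hE : i₁ + (k + 1) - a = E)
    (hF : c - i₂ + (k + 1) = F) :
    wTerm a b c i₁ i₂ (k + 1) = -(-1) ^ k * (invFact (k + 1) * invFact B * invFact C * invFact D
      * invFact E * invFact F) := by
  subst hB hC hD hE hF
  rw [wTerm, show ((k : ℤ) + 1).toNat = k + 1 by omega, pow_succ]; ring

theorem invFact_of_eq_sub_one {z w : ℤ} (h : w = z - 1) : invFact w = z * invFact z := by
  rw [mul_invFact, h]

/-- Multiplication of the generating polynomial by `y₁ x₂ - x₁ y₂`. -/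
theorem wSum_sub_wSum (a b c r₁ r₂ : ℤ) :
    wSum a b c (r₁ - 1) r₂ - wSum a b c r₁ (r₂ - 1) = (a + 1) * wSum (a + 1) b c r₁ r₂ := by
  obtain ⟨L, hL⟩ : ∃ L : ℕ, a + 1 < L := ⟨(a + 2).toNat, by omega⟩
  rw [wSum_eq_range a b c (r₁ - 1) r₂ (L := L) (by omega),
    wSum_eq_range a b c r₁ (r₂ - 1) (L := L) (by omega),
    wSum_eq_range (a + 1) b c r₁ r₂ hL, Finset.mul_sum,
    ← sub_eq_zero, ← Finset.sum_sub_distrib, ← Finset.sum_sub_distrib]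
  refine sum_eq_zero_of_telescope
    (fun k => wTerm a b c (r₁ - 1) r₂ k - wTerm a b c r₁ (r₂ - 1) k
      - (a + 1) * wTerm (a + 1) b c r₁ r₂ k)
    (fun k => k * wTerm (a + 1) b c r₁ r₂ k) L (by simp) ?_ fun k => ?_
  · simp only [wTerm_eq_zero (show _ ∨ a + 1 < (L : ℤ) ∨ _ from Or.inr (Or.inl hL)), mul_zero]
  · have hU : wTerm a b c (r₁ - 1) r₂ k = (a + 1 - k) * wTerm (a + 1) b c r₁ r₂ k := by
      rw [wTerm_natCast (a - k) (a + b + 1 - r₁ - k) (r₂ - k) (r₁ - 1 + k - a) (c - r₂ + k),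
        wTerm_natCast (a + 1 - k) (a + b + 1 - r₁ - k) (r₂ - k) (r₁ - 1 + k - a) (c - r₂ + k),
        invFact_of_eq_sub_one (w := a - k) (z := a + 1 - k)] <;> (push_cast; ring)
    have hV : wTerm a b c r₁ (r₂ - 1) k = -((k + 1) * wTerm (a + 1) b c r₁ r₂ (k + 1)) := by
      rw [wTerm_natCast (a - k) (a + b - r₁ - k) (r₂ - 1 - k) (r₁ + k - a) (c - r₂ + 1 + k),
        wTerm_natCast_succ (a - k) (a + b - r₁ - k) (r₂ - 1 - k) (r₁ + k - a) (c - r₂ + 1 + k),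
        invFact_of_eq_sub_one (w := k) (z := k + 1)] <;> (push_cast; ring)
    simp only [hU, hV]
    push_cast
    ring

/-- The polarization `x₁ ∂/∂x₂ + y₁ ∂/∂y₂` of the generating polynomial. -/
theorem wSum_polarize_right (a b c r₁ r₂ : ℤ) :
    r₂ * wSum a b c (r₁ - 1) r₂ + (a + c - r₂ + 1) * wSum a b c r₁ (r₂ - 1)
      = (b + 1) * wSum a (b + 1) (c - 1) r₁ (r₂ - 1) := by
  obtain ⟨L, hL⟩ : ∃ L : ℕ, a < L := ⟨(a + 1).toNat, by omega⟩
  rw [wSum_eq_range a b c (r₁ - 1) r₂ hL, wSum_eq_range a b c r₁ (r₂ - 1) hL,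
    wSum_eq_range a (b + 1) (c - 1) r₁ (r₂ - 1) hL, Finset.mul_sum, Finset.mul_sum,
    Finset.mul_sum, ← sub_eq_zero, ← Finset.sum_add_distrib, ← Finset.sum_sub_distrib]
  refine sum_eq_zero_of_telescope
    (fun k => r₂ * wTerm a b c (r₁ - 1) r₂ k + (a + c - r₂ + 1) * wTerm a b c r₁ (r₂ - 1) k
      - (b + 1) * wTerm a (b + 1) (c - 1) r₁ (r₂ - 1) k)
    (fun k => -(k * wTerm a b c (r₁ - 1) r₂ k)) L (by simp) ?_ fun k => ?_
  · simp only [wTerm_eq_zero (show _ ∨ a < (L : ℤ) ∨ _ from Or.inr (Or.inl hL)), mul_zero, neg_zero]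
  · have hU : (r₂ - k) * wTerm a b c (r₁ - 1) r₂ k
        = (r₁ + k - a) * wTerm a (b + 1) (c - 1) r₁ (r₂ - 1) k := by
      rw [wTerm_natCast (a - k) (a + b + 1 - r₁ - k) (r₂ - k) (r₁ - 1 + k - a) (c - r₂ + k),
        wTerm_natCast (a - k) (a + b + 1 - r₁ - k) (r₂ - 1 - k) (r₁ + k - a) (c - r₂ + k),
        invFact_of_eq_sub_one (w := r₂ - 1 - k) (z := r₂ - k),
        invFact_of_eq_sub_one (w := r₁ - 1 + k - a) (z := r₁ + k - a)] <;>
      (push_cast; ring)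
    have hV : (c - r₂ + 1 + k) * wTerm a b c r₁ (r₂ - 1) k
        = (a + b + 1 - r₁ - k) * wTerm a (b + 1) (c - 1) r₁ (r₂ - 1) k := by
      rw [wTerm_natCast (a - k) (a + b - r₁ - k) (r₂ - 1 - k) (r₁ + k - a) (c - r₂ + 1 + k),
        wTerm_natCast (a - k) (a + b + 1 - r₁ - k) (r₂ - 1 - k) (r₁ + k - a) (c - r₂ + k),
        invFact_of_eq_sub_one (w := a + b - r₁ - k) (z := a + b + 1 - r₁ - k),
        invFact_of_eq_sub_one (w := c - r₂ + k) (z := c - r₂ + 1 + k)] <;>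
      (push_cast; ring)
    have hZ : (k + 1) * wTerm a b c (r₁ - 1) r₂ (k + 1)
        = -((a - k) * wTerm a b c r₁ (r₂ - 1) k) := by
      rw [wTerm_natCast_succ (a - k - 1) (a + b - r₁ - k) (r₂ - 1 - k) (r₁ + k - a)
          (c - r₂ + 1 + k),
        wTerm_natCast (a - k) (a + b - r₁ - k) (r₂ - 1 - k) (r₁ + k - a) (c - r₂ + 1 + k),
        invFact_of_eq_sub_one (w := k) (z := k + 1),
        invFact_of_eq_sub_one (w := a - k - 1) (z := a - k)] <;>
      (push_cast; ring)
    push_cast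
    linear_combination hU + hV + hZ

/-- The substitution `k ↦ a - k` exchanges the two factors of the tensor product. -/
theorem wTerm_reflect {a : ℤ} (b c i₁ i₂ : ℤ) {k : ℕ} (hk : (k : ℤ) ≤ a) :
    wTerm a b c i₁ i₂ (a - k) = (-1) ^ a.toNat * wTerm a c b i₂ i₁ k := by
  have hs : (-1 : ℝ) ^ (a - k).toNat = (-1) ^ a.toNat * (-1) ^ k := by
    rw [show a.toNat = (a - k).toNat + k by omega, pow_add, mul_assoc, ← pow_add,
      ← two_mul, pow_mul]
    simp
  rw [wTerm, hs, wTerm_natCast (a - k) (a + c - i₂ - k) (i₁ - k) (i₂ + k - a) (b - i₁ + k)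
    rfl rfl rfl rfl rfl, show a - (a - (k : ℤ)) = k by ring,
    show a + b - i₁ - (a - (k : ℤ)) = b - i₁ + k by ring,
    show i₂ - (a - (k : ℤ)) = i₂ + k - a by ring, show i₁ + (a - (k : ℤ)) - a = i₁ - k by ring,
    show c - i₂ + (a - (k : ℤ)) = a + c - i₂ - k by ring]
  ring

/-- The symmetry of the Clebsch–Gordan coefficients under exchange of the two factors. -/
theorem wSum_swap (a b c i₁ i₂ : ℤ) :
    wSum a b c i₁ i₂ = (-1) ^ a.toNat * wSum a c b i₂ i₁ := by
  rw [wSum, wSum, ← Finset.sum_range_reflect, Finset.mul_sum]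
  refine Finset.sum_congr rfl fun k hk => ?_
  rw [Finset.mem_range] at hk
  rw [show (((a + 1).toNat - 1 - k : ℕ) : ℤ) = a - k by omega]
  exact wTerm_reflect b c i₁ i₂ (by omega)

/-- The polarization `x₂ ∂/∂x₁ + y₂ ∂/∂y₁` of the generating polynomial. -/
theorem wSum_polarize_left (a b c r₁ r₂ : ℤ) :
    (a + b - r₁ + 1) * wSum a b c (r₁ - 1) r₂ + r₁ * wSum a b c r₁ (r₂ - 1)
      = (c + 1) * wSum a (b - 1) (c + 1) (r₁ - 1) r₂ := by
  rw [wSum_swap a b c, wSum_swap a b c, wSum_swap a (b - 1) (c + 1)]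
  linear_combination (-1) ^ a.toNat * wSum_polarize_right a c b r₂ r₁

/-- Cayley's operator `∂/∂y₁ ∂/∂x₂ - ∂/∂x₁ ∂/∂y₂` applied to the generating polynomial. -/
theorem wSum_cayley (a b c r₁ r₂ : ℤ) :
    r₁ * (a + c - r₂ + 1) * wSum a b c r₁ (r₂ - 1)
        - (a + b - r₁ + 1) * r₂ * wSum a b c (r₁ - 1) r₂
      = (a + b + c + 1) * wSum (a - 1) b c (r₁ - 1) (r₂ - 1) := by
  obtain ⟨L, hL⟩ : ∃ L : ℕ, a < L := ⟨(a + 1).toNat, by omega⟩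
  rw [wSum_eq_range a b c (r₁ - 1) r₂ hL, wSum_eq_range a b c r₁ (r₂ - 1) hL,
    wSum_eq_range (a - 1) b c (r₁ - 1) (r₂ - 1) (L := L) (by omega), Finset.mul_sum,
    Finset.mul_sum, Finset.mul_sum, ← sub_eq_zero, ← Finset.sum_sub_distrib,
    ← Finset.sum_sub_distrib]
  refine sum_eq_zero_of_telescope
    (fun k => r₁ * (a + c - r₂ + 1) * wTerm a b c r₁ (r₂ - 1) k
      - (a + b - r₁ + 1) * r₂ * wTerm a b c (r₁ - 1) r₂ k
      - (a + b + c + 1) * wTerm (a - 1) b c (r₁ - 1) (r₂ - 1) k)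
    (fun k => (a + b + 1 - r₁ + r₂ - k) * (k * wTerm a b c (r₁ - 1) r₂ k)) L (by simp) ?_
    fun k => ?_
  · simp only [wTerm_eq_zero (show _ ∨ a < (L : ℤ) ∨ _ from Or.inr (Or.inl hL)), mul_zero]
  · have hV : (a - k) * wTerm a b c r₁ (r₂ - 1) k
        = wTerm (a - 1) b c (r₁ - 1) (r₂ - 1) k := by
      rw [wTerm_natCast (a - k) (a + b - r₁ - k) (r₂ - 1 - k) (r₁ + k - a) (c - r₂ + 1 + k),
        wTerm_natCast (a - 1 - k) (a + b - r₁ - k) (r₂ - 1 - k) (r₁ + k - a) (c - r₂ + 1 + k),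
        invFact_of_eq_sub_one (w := a - 1 - k) (z := a - k)] <;> (push_cast; ring)
    have hU : (k + 1) * wTerm a b c (r₁ - 1) r₂ (k + 1)
        = -wTerm (a - 1) b c (r₁ - 1) (r₂ - 1) k := by
      rw [wTerm_natCast_succ (a - 1 - k) (a + b - r₁ - k) (r₂ - 1 - k) (r₁ + k - a)
          (c - r₂ + 1 + k),
        wTerm_natCast (a - 1 - k) (a + b - r₁ - k) (r₂ - 1 - k) (r₁ + k - a) (c - r₂ + 1 + k),
        invFact_of_eq_sub_one (w := k) (z := k + 1)] <;> (push_cast; ring)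
    have hUV : (a + b + 1 - r₁ - k) * (r₂ - k) * wTerm a b c (r₁ - 1) r₂ k
        = (r₁ + k - a) * (c - r₂ + 1 + k) * wTerm a b c r₁ (r₂ - 1) k := by
      rw [wTerm_natCast (a - k) (a + b + 1 - r₁ - k) (r₂ - k) (r₁ - 1 + k - a) (c - r₂ + k),
        wTerm_natCast (a - k) (a + b - r₁ - k) (r₂ - 1 - k) (r₁ + k - a) (c - r₂ + 1 + k),
        invFact_of_eq_sub_one (w := a + b - r₁ - k) (z := a + b + 1 - r₁ - k),
        invFact_of_eq_sub_one (w := r₂ - 1 - k) (z := r₂ - k),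
        invFact_of_eq_sub_one (w := r₁ - 1 + k - a) (z := r₁ + k - a),
        invFact_of_eq_sub_one (w := c - r₂ + k) (z := c - r₂ + 1 + k)] <;> (push_cast; ring)
    push_cast
    linear_combination (r₁ + c - r₂ + 1 + k) * hV - (a + b - r₁ + r₂ - k : ℝ) * hU - hUV

/-! ### Clebsch–Gordan coefficients -/

theorem wSum_eq_zero_of_weight {a b c i₁ i₂ : ℤ} (h : i₁ + i₂ < a ∨ a + b + c < i₁ + i₂) :
    wSum a b c i₁ i₂ = 0 := by
  refine Finset.sum_eq_zero fun k _ => wTerm_eq_zero ?_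
  omega

/-- The factor `(ℓ - j)! (ℓ + j)!` attached to a weight, for `n = 2ℓ` and `i = ℓ + j`
(only used for `0 ≤ i ≤ n`). -/
def weightFact (n i : ℤ) : ℝ := (i.toNat.factorial : ℝ) * ((n - i).toNat.factorial : ℝ)

theorem weightFact_pos (n i : ℤ) : 0 < weightFact n i := by unfold weightFact; positivity

/-- The square of the norming factor of the Clebsch–Gordan coefficient for spins `(a + b) / 2`,
`(a + c) / 2` and `(b + c) / 2`. -/
def cgNormSq (a b c : ℕ) : ℝ :=
  ((b + c + 1 : ℕ) : ℝ) * b.factorial * c.factorial * a.factorial / (a + b + c + 1).factorial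

theorem cgNormSq_pos (a b c : ℕ) : 0 < cgNormSq a b c := by unfold cgNormSq; positivity

/-- Van der Waerden's formula in terms of the parameters `a = ℓ₁ + ℓ₂ - ℓ`, `b = ℓ + ℓ₁ - ℓ₂`,
`c = ℓ + ℓ₂ - ℓ₁`. -/
theorem clebschGordan_eq (a b c i₁ i₂ i : ℕ) :
    clebschGordan (a + b) (a + c) (b + c) i₁ i₂ i = if i₁ + i₂ = i + a then
      Real.sqrt (cgNormSq a b c) * Real.sqrt (weightFact (b + c) i)
        * Real.sqrt (weightFact (a + b) i₁) * Real.sqrt (weightFact (a + c) i₂)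
        * wSum a b c i₁ i₂ else 0 := by
  unfold clebschGordan
  by_cases h : i₁ ≤ a + b ∧ i₂ ≤ a + c ∧ i ≤ b + c ∧ i₁ + i₂ = i + a
  · obtain ⟨h1, h2, h3, h4⟩ := h
    rw [if_pos ⟨by omega, by omega, by omega, ⟨a + b + c, by omega⟩, h1, h2, h3, by omega⟩,
      if_pos h4]
    rw [show (a + b + (a + c) - (b + c)) / 2 = a by omega,
      show (b + c + (a + b) - (a + c)) / 2 = b by omega,
      show (b + c + (a + c) - (a + b)) / 2 = c by omega,
      show (a + b + (a + c) + (b + c)) / 2 = a + b + c by omega]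
    have hS : (∑ k ∈ (Finset.range (a + 1)).filter fun k =>
        k ≤ a + b - i₁ ∧ k ≤ i₂ ∧ a ≤ i₁ + k ∧ a ≤ a + c - i₂ + k,
        (-1 : ℝ) ^ k / ((k.factorial : ℝ) * (a - k).factorial * (a + b - i₁ - k).factorial
          * (i₂ - k).factorial * (i₁ + k - a).factorial * (a + c - i₂ + k - a).factorial))
        = wSum a b c i₁ i₂ := by
      rw [Finset.sum_filter, wSum_eq_range (L := a + 1) _ _ _ _ _ (by push_cast; omega)]
      refine Finset.sum_congr rfl fun k hk => ?_
      rw [Finset.mem_range] at hk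
      split_ifs with hc
      · obtain ⟨c1, c2, c3, c4⟩ := hc
        rw [wTerm_natCast ((a - k : ℕ) : ℤ) ((a + b - i₁ - k : ℕ) : ℤ) ((i₂ - k : ℕ) : ℤ)
          ((i₁ + k - a : ℕ) : ℤ) ((a + c - i₂ + k - a : ℕ) : ℤ) (by omega) (by omega) (by omega)
          (by omega) (by omega)]
        simp only [invFact_natCast, div_eq_mul_inv, mul_inv]
      · rw [wTerm_eq_zero]
        omega
    rw [hS]
    congr 1
    rw [← Real.sqrt_mul (by positivity : (0 : ℝ) ≤ _)]
    have e1 : weightFact (b + c) i = (i.factorial : ℝ) * (b + c - i).factorial := by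
      rw [weightFact, show (((b : ℤ) + c - i)).toNat = b + c - i by omega, Int.toNat_natCast]
    have e2 : weightFact (a + b) i₁ = (i₁.factorial : ℝ) * (a + b - i₁).factorial := by
      rw [weightFact, show (((a : ℤ) + b - i₁)).toNat = a + b - i₁ by omega, Int.toNat_natCast]
    have e3 : weightFact (a + c) i₂ = (i₂.factorial : ℝ) * (a + c - i₂).factorial := by
      rw [weightFact, show (((a : ℤ) + c - i₂)).toNat = a + c - i₂ by omega, Int.toNat_natCast]
    rw [e1, e2, e3, cgNormSq, ← Real.sqrt_mul (by positivity), ← Real.sqrt_mul (by positivity),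
      ← Real.sqrt_mul (by positivity)]
    congr 1
    ring
  · rw [if_neg (fun hh => h ⟨hh.2.2.2.2.1, hh.2.2.2.2.2.1, hh.2.2.2.2.2.2.1, by omega⟩)]
    split_ifs with h4
    · have : wSum a b c i₁ i₂ = 0 := by
        by_cases h1 : i₁ ≤ a + b
        · by_cases h2 : i₂ ≤ a + c
          · exact wSum_eq_zero_of_weight (by omega)
          · exact wSum_eq_zero (by omega)
        · exact wSum_eq_zero (by omega)
      rw [this, mul_zero]
    · rfl

/-- The coefficient of `X ^ a` in `(1 - X)⁻⁽ᶜ⁺¹⁾ (1 - X)⁻⁽ᵇ⁺¹⁾ = (1 - X)⁻⁽ᵇ⁺ᶜ⁺²⁾`. -/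
theorem sum_range_choose_mul_choose (a b c : ℕ) :
    ∑ k ∈ Finset.range (a + 1), (c + k).choose c * (b + (a - k)).choose b
      = (a + b + c + 1).choose a := by
  have h := congrArg (PowerSeries.coeff a)
    (congrArg Units.val (PowerSeries.invOneSubPow_add ℤ (c + 1) (b + 1)))
  rw [Units.val_mul, show c + 1 + (b + 1) = (b + c + 1) + 1 by ring,
    PowerSeries.invOneSubPow_val_succ_eq_mk_add_choose,
    PowerSeries.invOneSubPow_val_succ_eq_mk_add_choose,
    PowerSeries.invOneSubPow_val_succ_eq_mk_add_choose, PowerSeries.coeff_mk,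
    PowerSeries.coeff_mul, Finset.Nat.sum_antidiagonal_eq_sum_range_succ_mk] at h
  simp only [PowerSeries.coeff_mk] at h
  have h' : (b + c + 1 + a).choose (b + c + 1)
      = ∑ k ∈ Finset.range (a + 1), (c + k).choose c * (b + (a - k)).choose b := by
    exact_mod_cast h
  rw [← h', show a + b + c + 1 = b + c + 1 + a by ring, Nat.choose_symm_add]

/-- Van der Waerden's sum for the highest weight has a single nonzero term. -/
theorem wSum_top {a b c j k : ℕ} (h : j + k = a) :
    wSum a b c (b + j : ℕ) (c + k : ℕ) = (-1) ^ k *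
      ((k.factorial : ℝ)⁻¹ * (j.factorial : ℝ)⁻¹ * (b.factorial : ℝ)⁻¹ * (c.factorial : ℝ)⁻¹) := by
  rw [wSum, Finset.sum_eq_single k]
  · rw [wTerm_natCast (j : ℕ) (0 : ℕ) (c : ℕ) (b : ℕ) (0 : ℕ) (by omega) (by push_cast; omega)
      (by push_cast; omega) (by push_cast; omega) (by push_cast; omega)]
    simp only [invFact_natCast, Nat.factorial_zero, Nat.cast_one, inv_one]
    ring
  · intro i _ hi
    exact wTerm_eq_zero (by push_cast; omega)
  · intro hk
    simp only [Finset.mem_range] at hk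
    omega

theorem clebschGordan_sq (a b c i₁ i₂ i : ℕ) :
    clebschGordan (a + b) (a + c) (b + c) i₁ i₂ i ^ 2 = if i₁ + i₂ = i + a then
      cgNormSq a b c * weightFact (b + c) i * weightFact (a + b) i₁ * weightFact (a + c) i₂
        * wSum a b c i₁ i₂ ^ 2 else 0 := by
  rw [clebschGordan_eq]
  split_ifs
  · rw [mul_pow, mul_pow, mul_pow, mul_pow, Real.sq_sqrt (cgNormSq_pos a b c).le,
      Real.sq_sqrt (weightFact_pos _ _).le, Real.sq_sqrt (weightFact_pos _ _).le,
      Real.sq_sqrt (weightFact_pos _ _).le]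
  · norm_num

/-- The highest weight vector of `H^ℓ` in `H^{ℓ₁} ⊗ H^{ℓ₂}` is a unit vector. -/
theorem sum_clebschGordan_top_sq (a b c : ℕ) :
    ∑ i₁ : Fin (a + b + 1), ∑ i₂ : Fin (a + c + 1),
      clebschGordan (a + b) (a + c) (b + c) i₁ i₂ (b + c) ^ 2 = 1 := by
  have hin : ∀ j k : ℕ, j + k = a → ∑ i₂ ∈ Finset.range (a + c + 1),
      clebschGordan (a + b) (a + c) (b + c) (b + j) i₂ (b + c) ^ 2
      = ((c + k).choose c * (b + j).choose b : ℕ) / ((a + b + c + 1).choose a : ℕ) := by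
    intro j k hjk
    rw [Finset.sum_eq_single (c + k)]
    · rw [clebschGordan_sq, if_pos (by omega), wSum_top hjk]
      simp only [weightFact, Int.toNat_natCast]
      rw [show ((b : ℤ) + c - (b + c : ℕ)).toNat = 0 by push_cast; omega,
        show ((a : ℤ) + b - (b + j : ℕ)).toNat = k by push_cast; omega,
        show ((a : ℤ) + c - (c + k : ℕ)).toNat = j by push_cast; omega]
      rw [Nat.cast_mul, Nat.cast_add_choose ℝ, Nat.cast_add_choose ℝ,
        show a + b + c + 1 = a + (b + c + 1) by ring, Nat.cast_add_choose ℝ, cgNormSq,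
        show a + b + c + 1 = a + (b + c + 1) by ring, mul_pow, ← pow_mul, mul_comm k 2, pow_mul,
        neg_one_sq, one_pow, Nat.factorial_succ (b + c), Nat.factorial_zero]
      push_cast
      field_simp
    · intro i _ hi
      rw [clebschGordan_sq, if_neg (by omega)]
    · intro h
      simp only [Finset.mem_range] at h
      omega
  have hout : ∑ i₁ : Fin (a + b + 1), ∑ i₂ : Fin (a + c + 1),
      clebschGordan (a + b) (a + c) (b + c) i₁ i₂ (b + c) ^ 2
      = ∑ i₁ ∈ Finset.range (b + (a + 1)), ∑ i₂ ∈ Finset.range (a + c + 1),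
      clebschGordan (a + b) (a + c) (b + c) i₁ i₂ (b + c) ^ 2 := by
    rw [show b + (a + 1) = a + b + 1 by ring, Finset.sum_range]
    exact Finset.sum_congr rfl fun i _ => by rw [Finset.sum_range]
  rw [hout, Finset.sum_range_add, Finset.sum_eq_zero, zero_add, ← Finset.sum_range_reflect]
  · rw [Finset.sum_congr rfl fun k hk => hin (a + 1 - 1 - k) k
      (by rw [Finset.mem_range] at hk; omega), ← Finset.sum_div, ← Nat.cast_sum]
    simp only [Nat.add_sub_cancel]
    rw [sum_range_choose_mul_choose, div_self]
    exact_mod_cast (Nat.choose_pos (by omega)).ne'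
  · intro i hi
    refine Finset.sum_eq_zero fun j hj => ?_
    rw [Finset.mem_range] at hi hj
    rw [clebschGordan_sq, if_neg (by omega)]

theorem invFact_mul_invFact {l j : ℤ} (h0 : 0 ≤ j) (h1 : j ≤ l) :
    invFact j * invFact (l - j) = (weightFact l j)⁻¹ := by
  rw [invFact, invFact, if_pos h0, if_pos (by omega), weightFact, mul_inv]

/-- The linear factor in the Clebsch–Gordan coefficients of `H^{ℓ₁} ⊗ H^{1/2}`, `l = 2ℓ₁`, for the
component of spin `ℓ₁ + 1/2` (`s = 0`) or `ℓ₁ - 1/2` (`s = 1`). -/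
def halfFactor (s : ℕ) (l : ℤ) (j e : ℤ) : ℝ :=
  if s = 0 then 1 else if e = 0 then (j : ℝ) else -((l : ℝ) - j)

/-- The Clebsch–Gordan coefficients for `H^{ℓ₁} ⊗ H^{1/2} → H^{m}`, where `l = 2ℓ₁` and `m` is
one of `l ± 1`, in the shape common to both cases: `s = ℓ₁ + 1/2 - m / 2` is the shift of the
weight index, and `g` collects the factor that is linear in the weight. -/
def IsHalfCG (l m : ℕ) (s : ℤ) (g : ℤ → ℤ → ℝ) : Prop :=
  ∀ j e r : ℕ, j ≤ l → e ≤ 1 → clebschGordan l 1 m j e r = if (j : ℤ) + e = r + s then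
    Real.sqrt (weightFact m r) / (Real.sqrt (l + 1) * Real.sqrt (weightFact l j)) * g j e else 0

theorem sqrt_weightFact_mul_inv (l j : ℤ) :
    Real.sqrt (weightFact l j) * (weightFact l j)⁻¹ = (Real.sqrt (weightFact l j))⁻¹ := by
  rw [← div_eq_mul_inv, Real.sqrt_div_self]

theorem isHalfCG_succ (l : ℕ) : IsHalfCG l (l + 1) (0 : ℕ) (halfFactor 0 l) := by
  intro j e r hj he
  rw [show halfFactor 0 l j e = 1 by simp [halfFactor], Nat.cast_zero]
  have h := clebschGordan_eq 0 l 1 j e r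
  simp only [Nat.zero_add] at h
  rw [h]
  by_cases hr : j + e = r
  · rw [if_pos (by omega), if_pos (by omega)]
    have hN : cgNormSq 0 l 1 = ((l : ℝ) + 1)⁻¹ := by
      rw [cgNormSq, show 0 + l + 1 + 1 = (l + 1) + 1 by ring, Nat.factorial_succ (l + 1),
        Nat.factorial_succ l]
      push_cast
      field_simp
      simp
    have hS : wSum (0 : ℕ) l (1 : ℕ) j e = (weightFact l j)⁻¹ := by
      rw [← invFact_mul_invFact (by omega) (by omega), wSum]
      rcases (by omega : e = 0 ∨ e = 1) with rfl | rfl <;> simp [wTerm, invFact, mul_comm]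
    have hE : weightFact ((0 : ℕ) + (1 : ℕ)) e = 1 := by
      rcases (by omega : e = 0 ∨ e = 1) with rfl | rfl <;> simp [weightFact]
    rw [hN, hS, hE, Real.sqrt_one, Real.sqrt_inv]
    have := sqrt_weightFact_mul_inv l j
    simp only [Nat.cast_zero, zero_add, Nat.cast_one, Nat.cast_add, mul_one] at this ⊢
    rw [mul_assoc, this]
    field_simp
  · rw [if_neg (by omega), if_neg (by omega)]

theorem isHalfCG_pred (l : ℕ) :
    IsHalfCG (l + 1) l (1 : ℕ) (halfFactor 1 (l + 1 : ℕ)) := by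
  intro j e r hj he
  rw [show halfFactor 1 (l + 1 : ℕ) j e
    = if (e : ℤ) = 0 then ((j : ℤ) : ℝ) else -((l + 1 : ℝ) - (j : ℤ)) by simp [halfFactor],
    Nat.cast_one]
  have h := clebschGordan_eq 1 l 0 j e r
  rw [show 1 + l = l + 1 by ring] at h
  simp only [Nat.add_zero] at h
  rw [h]
  by_cases hr : j + e = r + 1
  · rw [if_pos (by omega), if_pos (by omega)]
    have hN : cgNormSq 1 l 0 = ((l : ℝ) + 1 + 1)⁻¹ := by
      rw [cgNormSq, show 1 + l + 0 + 1 = (l + 1) + 1 by ring, Nat.factorial_succ (l + 1),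
        Nat.factorial_succ l]
      push_cast
      field_simp
      simp
    have hS : wSum (1 : ℕ) l (0 : ℕ) j e = (weightFact (l + 1 : ℕ) j)⁻¹
        * (if (e : ℤ) = 0 then ((j : ℤ) : ℝ) else -((l + 1 : ℝ) - (j : ℤ))) := by
      have hj1 := mul_invFact j
      have hj2 := mul_invFact (l + 1 - j)
      rw [← invFact_mul_invFact (by omega) (by omega), wSum]
      rcases (by omega : e = 0 ∨ e = 1) with rfl | rfl
      · simp [wTerm, Finset.sum_range_succ, invFact_neg, show invFact 1 = 1 by simp [invFact],
          show invFact 0 = 1 by simp [invFact]]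
        rw [← hj1, show (1 : ℤ) + l - j = l + 1 - j by ring]
        push_cast
        ring
      · simp [wTerm, Finset.sum_range_succ, invFact_neg, show invFact 1 = 1 by simp [invFact],
          show invFact 0 = 1 by simp [invFact]]
        rw [show (1 : ℤ) + l - j - 1 = l + 1 - j - 1 by ring, ← hj2]
        push_cast
        ring
    have hE : weightFact ((1 : ℕ) + (0 : ℕ)) e = 1 := by
      rcases (by omega : e = 0 ∨ e = 1) with rfl | rfl <;> simp [weightFact]
    rw [hN, hS, hE, Real.sqrt_one, Real.sqrt_inv]
    have := sqrt_weightFact_mul_inv (l + 1) j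
    rw [show ((1 : ℕ) : ℤ) + l = l + 1 by push_cast; ring]
    simp only [Nat.cast_zero, add_zero, Nat.cast_one, Nat.cast_add, mul_one] at this ⊢
    rw [← mul_assoc, mul_assoc _ (Real.sqrt (weightFact (l + 1) j)), this]
    field_simp
  · rw [if_neg (by omega), if_neg (by omega)]

theorem clebschGordan_one_one_zero (i₁ i₂ : Fin 2) : clebschGordan 1 1 0 i₁ i₂ 0
    = if i₁ = 1 ∧ i₂ = 0 then (Real.sqrt 2)⁻¹ else if i₁ = 0 ∧ i₂ = 1 then -(Real.sqrt 2)⁻¹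
      else 0 := by
  have h := clebschGordan_eq 1 0 0 i₁ i₂ 0
  simp only [Nat.add_zero] at h
  rw [h]
  fin_cases i₁ <;> fin_cases i₂ <;>
    simp [cgNormSq, weightFact, wSum, wTerm, invFact, Finset.sum_range_succ]

/-! ### The coefficients of the recurrence -/

theorem sum_comm_cycle {α β γ : Type*} [Fintype α] [Fintype β] [Fintype γ] (f : α → β → γ → ℝ) :
    ∑ x, ∑ y, ∑ z, f x y z = ∑ y, ∑ z, ∑ x, f x y z := by
  rw [Finset.sum_comm]
  exact Finset.sum_congr rfl fun y _ => Finset.sum_comm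

theorem sum_sum_ite_eq (m n : ℕ) (A B : ℤ) (X : ℝ)
    (hX : A < 0 ∨ m < A ∨ B < 0 ∨ n < B → X = 0) :
    ∑ i : Fin (m + 1), ∑ j : Fin (n + 1), (if ((i : ℕ) : ℤ) = A ∧ ((j : ℕ) : ℤ) = B then X else 0)
      = X := by
  by_cases h : A < 0 ∨ m < A ∨ B < 0 ∨ n < B
  · simp [hX h]
  · push Not at h
    lift A to ℕ using h.1
    lift B to ℕ using h.2.2.1
    rw [Finset.sum_eq_single (⟨A, by omega⟩ : Fin (m + 1)),
      Finset.sum_eq_single (⟨B, by omega⟩ : Fin (n + 1))]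
    · simp
    · intro j _ hj
      rw [if_neg]
      exact fun hh => hj (Fin.ext (by simpa using hh.2))
    · simp
    · intro i _ hi
      refine Finset.sum_eq_zero fun j _ => ?_
      rw [if_neg]
      exact fun hh => hi (Fin.ext (by simpa using hh.1))
    · simp

/-- The combination of the two van der Waerden sums which appears when `β^{ℓ₁,ℓ₂}_ℓ ⊗ β^{½,½}_0`
is projected to the isotypic component determined by `g₁` and `g₂`. -/
def coupling (a b c : ℤ) (g₁ g₂ : ℤ → ℤ → ℝ) (R₁ R₂ : ℤ) : ℝ :=
  g₁ (R₁ - 1) 1 * g₂ R₂ 0 * wSum a b c (R₁ - 1) R₂ -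
    g₁ R₁ 0 * g₂ (R₂ - 1) 1 * wSum a b c R₁ (R₂ - 1)

/-- The projection of `β^{ℓ₁,ℓ₂}_ℓ ⊗ β^{½,½}_0` to an isotypic component, in coordinates.  Only the
weights `(i₁, i₂) = (½, -½)` and `(-½, ½)` contribute, whence the two terms of `coupling`. -/
theorem sum_coupled (a b c m₁ m₂ : ℕ) (s₁ s₂ : ℤ) (g₁ g₂ : ℤ → ℤ → ℝ)
    (h₁ : IsHalfCG (a + b) m₁ s₁ g₁) (h₂ : IsHalfCG (a + c) m₂ s₂ g₂) (r₁ r₂ q : ℕ) :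
    ∑ j₁ : Fin (a + b + 1), ∑ j₂ : Fin (a + c + 1), ∑ i₁ : Fin 2, ∑ i₂ : Fin 2,
      clebschGordan (a + b) (a + c) (b + c) j₁ j₂ q * clebschGordan 1 1 0 i₁ i₂ 0
        * clebschGordan (a + b) 1 m₁ j₁ i₁ r₁ * clebschGordan (a + c) 1 m₂ j₂ i₂ r₂
      = if (r₁ : ℤ) + r₂ + s₁ + s₂ = q + a + 1 then
        (Real.sqrt 2)⁻¹ * Real.sqrt (cgNormSq a b c)
          / (Real.sqrt ((a + b : ℕ) + 1) * Real.sqrt ((a + c : ℕ) + 1))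
          * Real.sqrt (weightFact (b + c) q) * Real.sqrt (weightFact m₁ r₁)
          * Real.sqrt (weightFact m₂ r₂) * coupling a b c g₁ g₂ (r₁ + s₁) (r₂ + s₂) else 0 := by
  have key : ∀ (e₁ e₂ : ℕ), e₁ ≤ 1 → e₂ ≤ 1 → e₁ + e₂ = 1 →
      ∑ j₁ : Fin (a + b + 1), ∑ j₂ : Fin (a + c + 1),
        clebschGordan (a + b) (a + c) (b + c) j₁ j₂ q
        * clebschGordan (a + b) 1 m₁ j₁ e₁ r₁ * clebschGordan (a + c) 1 m₂ j₂ e₂ r₂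
      = if (r₁ : ℤ) + r₂ + s₁ + s₂ = q + a + 1 then
        Real.sqrt (cgNormSq a b c)
          / (Real.sqrt ((a + b : ℕ) + 1) * Real.sqrt ((a + c : ℕ) + 1))
          * Real.sqrt (weightFact (b + c) q) * Real.sqrt (weightFact m₁ r₁)
          * Real.sqrt (weightFact m₂ r₂) * (g₁ (r₁ + s₁ - e₁) e₁ * g₂ (r₂ + s₂ - e₂) e₂ *
            wSum a b c (r₁ + s₁ - e₁) (r₂ + s₂ - e₂)) else 0 := by
    intro e₁ e₂ he₁ he₂ he
    rw [← sum_sum_ite_eq (a + b) (a + c) (r₁ + s₁ - e₁) (r₂ + s₂ - e₂) (ite _ _ _)]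
    · refine Finset.sum_congr rfl fun j₁ _ => Finset.sum_congr rfl fun j₂ _ => ?_
      rw [h₁ j₁ e₁ r₁ (by omega) he₁, h₂ j₂ e₂ r₂ (by omega) he₂, clebschGordan_eq]
      by_cases hc : ((j₁ : ℕ) : ℤ) = r₁ + s₁ - e₁ ∧ ((j₂ : ℕ) : ℤ) = r₂ + s₂ - e₂
      · rw [if_pos hc, if_pos (show ((j₁ : ℕ) : ℤ) + e₁ = r₁ + s₁ by omega),
          if_pos (show ((j₂ : ℕ) : ℤ) + e₂ = r₂ + s₂ by omega)]
        by_cases hq : (j₁ : ℕ) + (j₂ : ℕ) = q + a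
        · rw [if_pos hq, if_pos (by omega), ← hc.1, ← hc.2]
          have hw₁ := (Real.sqrt_pos.mpr (weightFact_pos (a + b) j₁)).ne'
          have hw₂ := (Real.sqrt_pos.mpr (weightFact_pos (a + c) j₂)).ne'
          push_cast
          field_simp
        · rw [if_neg hq, if_neg (by omega)]
          ring
      · rw [if_neg hc]
        by_cases hc₁ : ((j₁ : ℕ) : ℤ) + e₁ = r₁ + s₁
        · rw [if_neg (show ¬ ((j₂ : ℕ) : ℤ) + e₂ = r₂ + s₂ by omega), mul_zero]
        · rw [if_neg hc₁, mul_zero, zero_mul]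
    · intro h
      rw [wSum_eq_zero (by push_cast at h; omega)]
      simp
  have hsplit : ∀ (j₁ : Fin (a + b + 1)) (j₂ : Fin (a + c + 1)), ∑ i₁ : Fin 2, ∑ i₂ : Fin 2,
      clebschGordan (a + b) (a + c) (b + c) j₁ j₂ q * clebschGordan 1 1 0 i₁ i₂ 0
        * clebschGordan (a + b) 1 m₁ j₁ i₁ r₁ * clebschGordan (a + c) 1 m₂ j₂ i₂ r₂
      = (Real.sqrt 2)⁻¹ * (clebschGordan (a + b) (a + c) (b + c) j₁ j₂ q
        * clebschGordan (a + b) 1 m₁ j₁ 1 r₁ * clebschGordan (a + c) 1 m₂ j₂ 0 r₂)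
        - (Real.sqrt 2)⁻¹ * (clebschGordan (a + b) (a + c) (b + c) j₁ j₂ q
        * clebschGordan (a + b) 1 m₁ j₁ 0 r₁ * clebschGordan (a + c) 1 m₂ j₂ 1 r₂) := by
    intro j₁ j₂
    simp only [clebschGordan_one_one_zero, Fin.sum_univ_two]
    simp
    ring
  simp only [hsplit, Finset.sum_sub_distrib, ← Finset.mul_sum]
  have k1 := key 1 0 le_rfl zero_le_one rfl
  have k2 := key 0 1 zero_le_one le_rfl rfl
  rw [k1, k2]
  split_ifs
  · simp only [coupling, Nat.cast_one, Nat.cast_zero, sub_zero]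
    ring
  · ring

/-- The value of the coefficient `a^{(ℓ₁,ℓ₂)}_{(m₁,m₂),ℓ}`, when the coupled vectors are the
multiple `κ` of the Clebsch–Gordan vectors: the latter are normed, so only `κ` remains. -/
theorem recCoeff_eq (a b c a' b' c' m₁ m₂ : ℕ) (s₁ s₂ : ℤ) (g₁ g₂ : ℤ → ℤ → ℝ) (κ : ℝ)
    (h₁ : IsHalfCG (a + b) m₁ s₁ g₁) (h₂ : IsHalfCG (a + c) m₂ s₂ g₂)
    (hm₁ : m₁ = a' + b') (hm₂ : m₂ = a' + c') (hn : b' + c' = b + c) (hs : s₁ + s₂ + a' = a + 1)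
    (hκ : ∀ R₁ R₂ : ℤ, coupling a b c g₁ g₂ R₁ R₂ = κ * wSum a' b' c' (R₁ - s₁) (R₂ - s₂)) :
    recCoeff (b + c) (a + b, a + c) (m₁, m₂) = (Real.sqrt 2)⁻¹ * Real.sqrt (cgNormSq a b c)
      / (Real.sqrt ((a + b : ℕ) + 1) * Real.sqrt ((a + c : ℕ) + 1)) * κ
      / Real.sqrt (cgNormSq a' b' c') := by
  subst hm₁ hm₂
  have hN := (Real.sqrt_pos.mpr (cgNormSq_pos a' b' c')).ne'
  rw [recCoeff]
  refine (Finset.sum_congr rfl fun j₁ _ => (Finset.sum_congr rfl fun j₂ _ =>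
    (Finset.sum_congr rfl fun i₁ _ => sum_comm_cycle _).trans (sum_comm_cycle _)).trans
    (sum_comm_cycle _)).trans ((sum_comm_cycle _).trans ?_)
  simp only [← Finset.sum_mul]
  refine Eq.trans ?_ ((congrArg (HMul.hMul _) (sum_clebschGordan_top_sq a' b' c')).trans
    (mul_one _))
  rw [Finset.mul_sum]
  refine Finset.sum_congr rfl fun r₁ _ => ?_
  rw [Finset.mul_sum]
  refine Finset.sum_congr rfl fun r₂ _ => ?_
  rw [sum_coupled a b c (a' + b') (a' + c') s₁ s₂ g₁ g₂ h₁ h₂, hκ, ← hn]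
  refine Eq.trans (congrArg (· * _) ?_) (by rw [pow_two]; exact mul_assoc _ _ _)
  rw [clebschGordan_eq]
  by_cases h : (r₁ : ℕ) + (r₂ : ℕ) = b' + c' + a'
  · rw [if_pos h, if_pos (by push_cast; omega)]
    have hn' : (b : ℤ) + c = b' + c' := by exact_mod_cast hn.symm
    rw [add_sub_cancel_right, add_sub_cancel_right, hn']
    push_cast
    field_simp
  · rw [if_neg h, if_neg (by push_cast; omega), mul_zero]

theorem recCoeff_sq (a b c a' b' c' m₁ m₂ : ℕ) (s₁ s₂ : ℤ) (g₁ g₂ : ℤ → ℤ → ℝ) (κ : ℝ)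
    (h₁ : IsHalfCG (a + b) m₁ s₁ g₁) (h₂ : IsHalfCG (a + c) m₂ s₂ g₂)
    (hm₁ : m₁ = a' + b') (hm₂ : m₂ = a' + c') (hn : b' + c' = b + c) (hs : s₁ + s₂ + a' = a + 1)
    (hκ : ∀ R₁ R₂ : ℤ, coupling a b c g₁ g₂ R₁ R₂ = κ * wSum a' b' c' (R₁ - s₁) (R₂ - s₂)) :
    |recCoeff (b + c) (a + b, a + c) (m₁, m₂)| ^ 2 = cgNormSq a b c
      / (2 * ((a + b : ℕ) + 1) * ((a + c : ℕ) + 1)) * κ ^ 2 / cgNormSq a' b' c' := by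
  rw [sq_abs, recCoeff_eq a b c a' b' c' m₁ m₂ s₁ s₂ g₁ g₂ κ h₁ h₂ hm₁ hm₂ hn hs hκ]
  simp only [div_pow, mul_pow, inv_pow]
  rw [Real.sq_sqrt (cgNormSq_pos _ _ _).le, Real.sq_sqrt (cgNormSq_pos _ _ _).le,
    Real.sq_sqrt (by positivity), Real.sq_sqrt (by positivity), Real.sq_sqrt (by positivity)]
  field_simp

/-! ### Parseval's identity for the four components -/

theorem coupling_zero_zero (a b c R₁ R₂ : ℤ) :
    coupling a b c (halfFactor 0 (a + b)) (halfFactor 0 (a + c)) R₁ R₂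
      = (a + 1) * wSum (a + 1) b c R₁ R₂ := by
  rw [← wSum_sub_wSum]
  simp [coupling, halfFactor]

theorem coupling_one_zero (a b c R₁ R₂ : ℤ) :
    coupling a b c (halfFactor 1 (a + b)) (halfFactor 0 (a + c)) R₁ R₂
      = -(c + 1) * wSum a (b - 1) (c + 1) (R₁ - 1) R₂ := by
  rw [neg_mul, ← wSum_polarize_left]
  simp [coupling, halfFactor]
  ring

theorem coupling_zero_one (a b c R₁ R₂ : ℤ) :
    coupling a b c (halfFactor 0 (a + b)) (halfFactor 1 (a + c)) R₁ R₂
      = (b + 1) * wSum a (b + 1) (c - 1) R₁ (R₂ - 1) := by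
  rw [← wSum_polarize_right]
  simp [coupling, halfFactor]
  ring

theorem coupling_one_one (a b c R₁ R₂ : ℤ) :
    coupling a b c (halfFactor 1 (a + b)) (halfFactor 1 (a + c)) R₁ R₂
      = (a + b + c + 1) * wSum (a - 1) b c (R₁ - 1) (R₂ - 1) := by
  rw [← wSum_cayley]
  simp [coupling, halfFactor]
  ring

theorem weightFact_natCast {n i k : ℕ} (h : i + k = n) :
    weightFact n i = i.factorial * k.factorial := by
  rw [weightFact, Int.toNat_natCast, show ((n : ℤ) - i).toNat = k by omega]

/-- The Clebsch–Gordan coefficients of `H^{l/2} ⊗ H^{1/2}` with second weight `1/2` have squares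
summing to `1`, in unnormalized form. -/
theorem weightFact_upper {l : ℤ} {j : ℤ} (h0 : 0 ≤ j) (h1 : j ≤ l) :
    weightFact (l + 1) (j + 1) + (l - j) ^ 2 * weightFact (l - 1) j = (l + 1) * weightFact l j := by
  lift j to ℕ using h0
  obtain ⟨k, rfl⟩ : ∃ k : ℕ, l = j + k := ⟨(l - j).toNat, by omega⟩
  simp only [weightFact, show ((j : ℤ) + 1).toNat = j + 1 by omega, Int.toNat_natCast,
    show ((j : ℤ) + k + 1 - (j + 1)).toNat = k by omega, show ((j : ℤ) + k - j).toNat = k by omega]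
  cases k with
  | zero => simp [Nat.factorial_succ]
  | succ k =>
    rw [show ((j : ℤ) + (k + 1 : ℕ) - 1 - j).toNat = k by push_cast; omega, Nat.factorial_succ,
      Nat.factorial_succ]
    push_cast
    ring

/-- The companion of `weightFact_upper` for the second weight `-1/2`. -/
theorem weightFact_lower {l : ℤ} {j : ℤ} (h0 : 0 ≤ j) (h1 : j ≤ l) :
    weightFact (l + 1) j + j ^ 2 * weightFact (l - 1) (j - 1) = (l + 1) * weightFact l j := by
  lift j to ℕ using h0
  obtain ⟨k, rfl⟩ : ∃ k : ℕ, l = j + k := ⟨(l - j).toNat, by omega⟩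
  simp only [weightFact, Int.toNat_natCast, show ((j : ℤ) + k - 1 - (j - 1)).toNat = k by omega,
    show ((j : ℤ) + k + 1 - j).toNat = k + 1 by omega, show ((j : ℤ) + k - j).toNat = k by omega]
  cases j with
  | zero => simp [Nat.factorial_succ]
  | succ j =>
    rw [show (((j + 1 : ℕ) : ℤ) - 1).toNat = j by push_cast; omega, Nat.factorial_succ,
      Nat.factorial_succ]
    push_cast
    ring

/-- The orthogonality of the two sets of coefficients of `weightFact_upper` and
`weightFact_lower`. -/
theorem weightFact_cross {l : ℤ} {j : ℤ} (h0 : 1 ≤ j) (h1 : j ≤ l) :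
    weightFact (l + 1) j = j * (l - j + 1) * weightFact (l - 1) (j - 1) := by
  obtain ⟨i, rfl⟩ : ∃ i : ℕ, j = i + 1 := ⟨(j - 1).toNat, by omega⟩
  obtain ⟨k, rfl⟩ : ∃ k : ℕ, l = i + 1 + k := ⟨(l - i - 1).toNat, by omega⟩
  simp only [weightFact, show ((i : ℤ) + 1).toNat = i + 1 by omega,
    show ((i : ℤ) + 1 + k + 1 - (i + 1)).toNat = k + 1 by omega,
    show ((i : ℤ) + 1 - 1).toNat = i by omega,
    show ((i : ℤ) + 1 + k - 1 - (i + 1 - 1)).toNat = k by omega, Nat.factorial_succ]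
  push_cast
  ring

/-- Parseval's identity for the decomposition of
`(H^{ℓ₁} ⊗ H^{1/2}) ⊗ (H^{ℓ₂} ⊗ H^{1/2})` into four irreducible components, for a fixed pair of
weights and in terms of the unnormalized coefficients: the four squares on the right belong to
the components. -/
theorem parseval_coupling (a b c R₁ R₂ : ℤ) :
    ((a + b + 1) * (a + c + 1) : ℝ)
      * (weightFact (a + b) (R₁ - 1) * weightFact (a + c) R₂ * wSum a b c (R₁ - 1) R₂ ^ 2
        + weightFact (a + b) R₁ * weightFact (a + c) (R₂ - 1) * wSum a b c R₁ (R₂ - 1) ^ 2)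
      = weightFact (a + b + 1) R₁ * weightFact (a + c + 1) R₂
          * coupling a b c (halfFactor 0 (a + b)) (halfFactor 0 (a + c)) R₁ R₂ ^ 2
        + weightFact (a + b - 1) (R₁ - 1) * weightFact (a + c + 1) R₂
          * coupling a b c (halfFactor 1 (a + b)) (halfFactor 0 (a + c)) R₁ R₂ ^ 2
        + weightFact (a + b + 1) R₁ * weightFact (a + c - 1) (R₂ - 1)
          * coupling a b c (halfFactor 0 (a + b)) (halfFactor 1 (a + c)) R₁ R₂ ^ 2
        + weightFact (a + b - 1) (R₁ - 1) * weightFact (a + c - 1) (R₂ - 1)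
          * coupling a b c (halfFactor 1 (a + b)) (halfFactor 1 (a + c)) R₁ R₂ ^ 2 := by
  have hU : wSum a b c (R₁ - 1) R₂ = 0 ∨ (0 ≤ R₁ - 1 ∧ R₁ - 1 ≤ a + b ∧ 0 ≤ R₂ ∧ R₂ ≤ a + c) := by
    by_contra! h
    exact h.1 (wSum_eq_zero (by have := h.2; omega))
  have hV : wSum a b c R₁ (R₂ - 1) = 0 ∨ (0 ≤ R₁ ∧ R₁ ≤ a + b ∧ 0 ≤ R₂ - 1 ∧ R₂ - 1 ≤ a + c) := by
    by_contra! h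
    exact h.1 (wSum_eq_zero (by have := h.2; omega))
  simp only [coupling, halfFactor, if_true, one_ne_zero, if_false]
  generalize wSum a b c (R₁ - 1) R₂ = U at *
  generalize wSum a b c R₁ (R₂ - 1) = V at *
  push_cast
  have hUU : U ^ 2 * ((weightFact (a + b + 1) R₁
        + (a + b - R₁ + 1) ^ 2 * weightFact (a + b - 1) (R₁ - 1))
      * (weightFact (a + c + 1) R₂ + R₂ ^ 2 * weightFact (a + c - 1) (R₂ - 1)))
      = U ^ 2 * ((a + b + 1) * weightFact (a + b) (R₁ - 1)
        * ((a + c + 1) * weightFact (a + c) R₂)) := by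
    rcases hU with rfl | ⟨h1, h2, h3, h4⟩
    · simp
    · have e1 := weightFact_upper h1 h2
      have e2 := weightFact_lower h3 h4
      rw [sub_add_cancel] at e1
      push_cast at e1 e2
      rw [← e1, ← e2]
      ring
  have hVV : V ^ 2 * ((weightFact (a + b + 1) R₁ + R₁ ^ 2 * weightFact (a + b - 1) (R₁ - 1))
      * (weightFact (a + c + 1) R₂
        + (a + c - R₂ + 1) ^ 2 * weightFact (a + c - 1) (R₂ - 1)))
      = V ^ 2 * ((a + b + 1) * weightFact (a + b) R₁
        * ((a + c + 1) * weightFact (a + c) (R₂ - 1))) := by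
    rcases hV with rfl | ⟨h1, h2, h3, h4⟩
    · simp
    · have e1 := weightFact_lower h1 h2
      have e2 := weightFact_upper h3 h4
      rw [sub_add_cancel] at e2
      push_cast at e1 e2
      rw [← e1, ← e2]
      ring
  have hUV : U * V * (weightFact (a + b + 1) R₁
      - R₁ * (a + b - R₁ + 1) * weightFact (a + b - 1) (R₁ - 1)) = 0 := by
    rcases hU with rfl | ⟨h1, h2, h3, h4⟩
    · simp
    · rcases hV with rfl | ⟨h5, h6, h7, h8⟩
      · simp
      · have := weightFact_cross (show 1 ≤ R₁ by omega) h6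
        push_cast at this
        rw [this, sub_self, mul_zero]
  linear_combination -hUU - hVV + 2 * (weightFact (a + c + 1) R₂
    - R₂ * (a + c - R₂ + 1) * weightFact (a + c - 1) (R₂ - 1)) * hUV

/-! ### Spherical functions on the torus -/

/-- The character `m_t ↦ e^{ikt/2}` of the torus of `SU(2)`. -/
def phase (t : ℝ) (k : ℤ) : ℂ := Complex.exp (Complex.I * t / 2 * k)

theorem phase_add (t : ℝ) (k l : ℤ) : phase t (k + l) = phase t k * phase t l := by
  rw [phase, phase, phase, ← Complex.exp_add]
  push_cast
  ring_nf

theorem two_mul_cos_mul_phase (t : ℝ) (k : ℤ) :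
    2 * Complex.cos t * phase t k = phase t (k + 2) + phase t (k - 2) := by
  rw [sub_eq_add_neg, phase_add, phase_add, Complex.two_cos, phase, phase, phase]
  push_cast
  ring_nf

theorem T_m_psi (n : ℕ) (t : ℝ) (i : Fin (n + 1)) :
    T n (m t) (psi n i) = phase t (n - 2 * i) • psi n i := by
  have hX : ∀ j : Fin 2, subst (m t) (MvPolynomial.X j)
      = MvPolynomial.C (phase t (1 - 2 * (j : ℕ))) * MvPolynomial.X j := by
    intro j
    rw [subst, MvPolynomial.aeval_X]
    fin_cases j
    · simp [m, phase, Fin.sum_univ_two]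
    · simp [m, phase, Fin.sum_univ_two, ← Complex.exp_conj]
      congr 1
      rw [show (starRingEnd ℂ) (2 : ℂ) = 2 from Complex.conj_ofNat 2]
      ring
  have hpow : ∀ (k : ℤ) (r : ℕ), phase t k ^ r = phase t (r * k) := by
    intro k r
    rw [phase, phase, ← Complex.exp_nat_mul]
    push_cast
    ring_nf
  have hmon : ∀ s : ℂ, MvPolynomial.monomial (expo n i) s
      = MvPolynomial.C s * MvPolynomial.X 0 ^ (n - (i : ℕ)) * MvPolynomial.X 1 ^ (i : ℕ) := by
    intro s
    rw [expo, MvPolynomial.monomial_add_single, MvPolynomial.C_mul_X_pow_eq_monomial]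
  apply Subtype.ext
  change subst (m t) (psi n i).1 = phase t (n - 2 * i) • (psi n i).1
  rw [psi]
  dsimp only
  rw [hmon, map_mul, map_mul, map_pow, map_pow, hX, hX, mul_pow, mul_pow, ← map_pow, ← map_pow,
    hpow, hpow, MvPolynomial.smul_eq_C_mul, ← MvPolynomial.algebraMap_eq, AlgHom.commutes,
    show (n : ℤ) - 2 * i = (n - (i : ℕ) : ℕ) * (1 - 2 * ((0 : Fin 2) : ℕ))
      + (i : ℕ) * (1 - 2 * ((1 : Fin 2) : ℕ)) by
        simp only [Fin.val_zero, Fin.val_one]; push_cast; omega, phase_add, map_mul]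
  ring

/-- A diagonal matrix entry of a spherical function on the torus `A_*`. -/
def diagEntry (n₁ n₂ n q : ℕ) (t : ℝ) : ℂ :=
  ∑ i₁ : Fin (n₁ + 1), ∑ i₂ : Fin (n₂ + 1), ((clebschGordan n₁ n₂ n i₁ i₂ q ^ 2 : ℝ) : ℂ)
    * phase t ((n₁ - 2 * i₁) - (n₂ - 2 * i₂))

theorem inner_spherical (n n₁ n₂ : ℕ) (q : Fin (n + 1)) (t : ℝ) :
    inner ℂ (psi n q) (spherical n (n₁, n₂) (torusElt t) (psi n q)) = diagEntry n₁ n₂ n q t := by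
  have hT : ∀ (i₁ : Fin (n₁ + 1)) (i₂ : Fin (n₂ + 1)),
      TT n₁ n₂ (torusElt t) (psi n₁ i₁ ⊗ₜ psi n₂ i₂)
        = phase t ((n₁ - 2 * i₁) - (n₂ - 2 * i₂)) • (psi n₁ i₁ ⊗ₜ[ℂ] psi n₂ i₂) := by
    intro i₁ i₂
    have hp : phase (-t) (n₂ - 2 * i₂) = phase t (-(n₂ - 2 * i₂)) := by
      simp only [phase]; push_cast; ring_nf
    rw [TT, TensorProduct.map_tmul, torusElt, T_m_psi, T_m_psi, TensorProduct.smul_tmul_smul, hp,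
      ← phase_add]
    rfl
  rw [spherical, LinearMap.comp_apply, LinearMap.comp_apply, LinearMap.adjoint_inner_right,
    beta_psi, cgVector]
  have hl (z : ℂ) (x y : H n₁ ⊗[ℂ] H n₂) := inner_smul_left (𝕜 := ℂ) x y z
  have hr (z : ℂ) (x y : H n₁ ⊗[ℂ] H n₂) := inner_smul_right (𝕜 := ℂ) x y z
  have ht (i₁ i₁' : Fin (n₁ + 1)) (i₂ i₂' : Fin (n₂ + 1)) :
      inner ℂ (psi n₁ i₁ ⊗ₜ[ℂ] psi n₂ i₂) (psi n₁ i₁' ⊗ₜ[ℂ] psi n₂ i₂')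
        = (if i₁ = i₁' then 1 else 0) * (if i₂ = i₂' then 1 else 0) := by
    rw [TensorProduct.inner_tmul, orthonormal_iff_ite.mp (orthonormal_psi _),
      orthonormal_iff_ite.mp (orthonormal_psi _)]
  simp only [map_sum, map_smul, hT, sum_inner, inner_sum, hl, hr, ht]
  simp only [mul_ite, mul_zero, mul_one, Finset.sum_ite_eq',
    Finset.mem_univ, if_true, Complex.conj_ofReal]
  rw [diagEntry]
  refine Finset.sum_congr rfl fun i₁ _ => Finset.sum_congr rfl fun i₂ _ => ?_
  push_cast
  ring

theorem zonal_torusElt (t : ℝ) : zonal (torusElt t) = Complex.cos t := by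
  have h := inner_spherical 0 1 1 0 t
  rw [zonal]
  refine h.trans ?_
  have h1 : ((Real.sqrt 2)⁻¹ : ℝ) ^ 2 = 1 / 2 := by
    rw [inv_pow, Real.sq_sqrt (by norm_num)]; norm_num
  have h2 := two_mul_cos_mul_phase t 0
  have h3 := clebschGordan_one_one_zero 0 0
  have h4 := clebschGordan_one_one_zero 0 1
  have h5 := clebschGordan_one_one_zero 1 0
  have h6 := clebschGordan_one_one_zero 1 1
  simp only [diagEntry]
  rw [Fin.sum_univ_two, Fin.sum_univ_two, Fin.sum_univ_two]
  rw [Fin.val_zero] at *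
  rw [Fin.val_one] at *
  rw [show ((0 : Fin (0 + 1)) : ℕ) = 0 from rfl, h3, h4, h5, h6]
  simp [h1]
  have h0 : phase t 0 = 1 := by simp [phase]
  rw [h0] at h2
  norm_num at h2 ⊢
  linear_combination (-1/2 : ℂ) * h2

theorem fullSpherical_torusElt (n d : ℕ) (t : ℝ) (p q : Fin (n + 1)) :
    fullSpherical n d (torusElt t) p q = diagEntry (d + p) (d + (n - p)) n q t :=
  inner_spherical n _ _ q t

theorem sum_range_shift (f : ℤ → ℂ) (s M k : ℕ) (hneg : ∀ z < 0, f z = 0)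
    (hbig : ∀ z : ℤ, k < z → f z = 0) (hM : k < M) :
    ∑ r ∈ Finset.range (s + M), f (r - s) = ∑ r ∈ Finset.range (k + 1), f r := by
  rw [Finset.sum_range_add, Finset.sum_eq_zero, zero_add]
  · rw [Finset.sum_subset (Finset.range_subset_range.mpr (show k + 1 ≤ M from hM))]
    · exact Finset.sum_congr rfl fun r _ => by push_cast; ring_nf
    · intro r _ hr
      rw [Finset.mem_range] at hr
      exact hbig r (by omega)
  · intro r hr
    rw [Finset.mem_range] at hr
    exact hneg _ (by omega)

theorem diagEntry_eq (a b c q : ℕ) (t : ℝ) : diagEntry (a + b) (a + c) (b + c) q t =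
    ∑ r ∈ Finset.range (a + b + 1), ((cgNormSq a b c * weightFact (b + c) q * weightFact (a + b) r
      * weightFact (a + c) (q + a - r) * wSum a b c r (q + a - r) ^ 2 : ℝ) : ℂ)
      * phase t (b - c + 2 * q + 2 * a - 4 * r) := by
  rw [diagEntry, Finset.sum_range]
  refine Finset.sum_congr rfl fun i₁ _ => ?_
  simp only [clebschGordan_sq]
  by_cases h : (i₁ : ℕ) ≤ q + a ∧ q + a ≤ i₁ + (a + c)
  · rw [Finset.sum_eq_single (⟨q + a - i₁, by omega⟩ : Fin (a + c + 1))]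
    · rw [if_pos (show (i₁ : ℕ) + (q + a - i₁) = q + a by omega)]
      dsimp only
      rw [show ((q + a - i₁ : ℕ) : ℤ) = q + a - i₁ by omega]
      congr 2
      push_cast
      ring
    · intro j _ hj
      rw [if_neg, Complex.ofReal_zero, zero_mul]
      exact fun hh => hj (Fin.ext (by dsimp only; omega))
    · simp
  · rw [wSum_eq_zero (by omega), Finset.sum_eq_zero]
    · simp
    · intro j _
      rw [if_neg (by omega), Complex.ofReal_zero, zero_mul]

/-- The contribution to `φ Φ^ℓ_{ℓ₁,ℓ₂}` of the component of
`H^{ℓ₁} ⊗ H^{1/2} ⊗ H^{ℓ₂} ⊗ H^{1/2}` selected by `s₁, s₂ ∈ {0, 1}`, of spins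
`(ℓ₁ + 1/2 - s₁, ℓ₂ + 1/2 - s₂)`. -/
def component (a b c q : ℕ) (t : ℝ) (s₁ s₂ : ℕ) : ℂ :=
  ∑ r ∈ Finset.range (a + b + 2),
    ((cgNormSq a b c / (2 * (a + b + 1) * (a + c + 1)) * weightFact (b + c) q
      * weightFact (a + b + 1 - 2 * s₁) (r - s₁)
      * weightFact (a + c + 1 - 2 * s₂) (q + a + 1 - r - s₂)
      * coupling a b c (halfFactor s₁ (a + b)) (halfFactor s₂ (a + c)) r (q + a + 1 - r) ^ 2 : ℝ)
        : ℂ) * phase t (b - c + 2 * q + 2 * a + 2 - 4 * r)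

/-- Parseval's identity summed against the characters of the torus. -/
theorem cos_mul_diagEntry (a b c q : ℕ) (t : ℝ) :
    Complex.cos t * diagEntry (a + b) (a + c) (b + c) q t
      = component a b c q t 0 0 + component a b c q t 1 0 + component a b c q t 0 1
        + component a b c q t 1 1 := by
  have key : ∀ f : ℤ → ℝ, (∀ z < 0, f z = 0) → (∀ z : ℤ, (a + b : ℕ) < z → f z = 0) → ∀ F : ℤ,
      2 * Complex.cos t * ∑ r ∈ Finset.range (a + b + 1), (f r : ℂ) * phase t (F - 4 * r)
        = ∑ r ∈ Finset.range (a + b + 2), ((f (r - 1) + f r : ℝ) : ℂ)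
          * phase t (F + 2 - 4 * r) := by
    intro f h1 h2 F
    have e1 := sum_range_shift (fun z => (f z : ℂ) * phase t (F - 4 * z - 2)) 1 (a + b + 1) (a + b)
      (fun z hz => by simp [h1 z hz]) (fun z hz => by simp [h2 z hz]) (by omega)
    have e2 := sum_range_shift (fun z => (f z : ℂ) * phase t (F - 4 * z + 2)) 0 (a + b + 2) (a + b)
      (fun z hz => by simp [h1 z hz]) (fun z hz => by simp [h2 z hz]) (by omega)
    rw [Finset.mul_sum]
    have e3 : ∑ r ∈ Finset.range (a + b + 1),
        2 * Complex.cos t * ((f r : ℂ) * phase t (F - 4 * r))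
        = ∑ r ∈ Finset.range (a + b + 1), (f r : ℂ) * phase t (F - 4 * r - 2)
          + ∑ r ∈ Finset.range (a + b + 1), (f r : ℂ) * phase t (F - 4 * r + 2) := by
      rw [← Finset.sum_add_distrib]
      refine Finset.sum_congr rfl fun r _ => ?_
      linear_combination (f r : ℂ) * two_mul_cos_mul_phase t (F - 4 * r)
    rw [e3, ← e1, ← e2, show 1 + (a + b + 1) = a + b + 2 by ring, zero_add,
      ← Finset.sum_add_distrib]
    refine Finset.sum_congr rfl fun r _ => ?_
    rw [show F - 4 * ((r : ℤ) - (1 : ℕ)) - 2 = F + 2 - 4 * r by push_cast; ring,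
      show F - 4 * ((r : ℤ) - (0 : ℕ)) + 2 = F + 2 - 4 * r by push_cast; ring]
    push_cast
    rw [sub_zero]
    ring
  have h := key (fun r => cgNormSq a b c * weightFact (b + c) q * weightFact (a + b) r
      * weightFact (a + c) (q + a - r) * wSum a b c r (q + a - r) ^ 2)
    (fun z hz => by rw [wSum_eq_zero (by omega)]; simp)
    (fun z hz => by rw [wSum_eq_zero (by push_cast at hz; omega)]; simp)
    (b - c + 2 * q + 2 * a)
  have h2 : (2 : ℂ) ≠ 0 := two_ne_zero
  refine mul_left_cancel₀ h2 ?_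
  rw [diagEntry_eq, ← mul_assoc, h]
  simp only [component, ← Finset.sum_add_distrib, Finset.mul_sum, ← add_mul]
  refine Finset.sum_congr rfl fun r _ => ?_
  rw [← mul_assoc]
  congr 1
  have hp := parseval_coupling a b c r (q + a + 1 - r)
  rw [show (q : ℤ) + a + 1 - r - 1 = q + a - r by ring] at hp
  rw [show (q : ℤ) + a - (r - 1) = q + a + 1 - r by ring]
  simp only [Nat.cast_zero, Nat.cast_one, mul_zero, sub_zero, mul_one]
  rw [show (a : ℤ) + b + 1 - 2 = a + b - 1 by ring, show (a : ℤ) + c + 1 - 2 = a + c - 1 by ring,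
    show (q : ℤ) + a + 1 - r - 1 = q + a - r by ring]
  have hp' := congrArg Complex.ofReal hp
  have n1 : (a : ℂ) + b + 1 ≠ 0 := by exact_mod_cast Nat.succ_ne_zero (a + b)
  have n2 : (a : ℂ) + c + 1 ≠ 0 := by exact_mod_cast Nat.succ_ne_zero (a + c)
  push_cast at hp' ⊢
  field_simp
  linear_combination (cgNormSq a b c * weightFact (b + c) q : ℂ) * hp'

/-- An admissible component is a spherical function: the coupled vectors are `κ` times the
Clebsch–Gordan vectors, and `κ` is absorbed by the coefficient of the recurrence. -/
theorem component_eq (a b c a' b' c' q : ℕ) (t : ℝ) (s₁ s₂ : ℕ) (κ : ℝ) (hs₁ : s₁ ≤ 1)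
    (hs₂ : s₂ ≤ 1) (hm₁ : a' + b' + 2 * s₁ = a + b + 1) (hm₂ : a' + c' + 2 * s₂ = a + c + 1)
    (ha : s₁ + s₂ + a' = a + 1)
    (hκ : ∀ R₁ R₂ : ℤ, coupling a b c (halfFactor s₁ (a + b)) (halfFactor s₂ (a + c)) R₁ R₂
      = κ * wSum a' b' c' (R₁ - s₁) (R₂ - s₂)) :
    component a b c q t s₁ s₂
      = ((|recCoeff (b + c) (a + b, a + c) (a' + b', a' + c')| ^ 2 : ℝ) : ℂ)
        * diagEntry (a' + b') (a' + c') (b + c) q t := by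
  have isHalf : ∀ l m s : ℕ, s ≤ 1 → m + 2 * s = l + 1 → IsHalfCG l m s (halfFactor s l) := by
    intro l m s hs hm
    rcases (by omega : s = 0 ∨ s = 1) with rfl | rfl
    · obtain rfl : m = l + 1 := by omega
      exact isHalfCG_succ l
    · obtain rfl : l = m + 1 := by omega
      exact isHalfCG_pred m
  have h₁ := isHalf (a + b) (a' + b') s₁ hs₁ hm₁
  have h₂ := isHalf (a + c) (a' + c') s₂ hs₂ hm₂
  have hn : b' + c' = b + c := by omega
  rw [Nat.cast_add] at h₁ h₂
  rw [recCoeff_sq a b c a' b' c' _ _ s₁ s₂ _ _ κ h₁ h₂ rfl rfl hn (by omega) hκ, ← hn,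
    diagEntry_eq, Finset.mul_sum, component]
  have hshift := sum_range_shift (fun r => ((cgNormSq a b c
      / (2 * ((a + b : ℕ) + 1) * ((a + c : ℕ) + 1)) * κ ^ 2 / cgNormSq a' b' c' : ℝ) : ℂ)
      * (((cgNormSq a' b' c' * weightFact (b' + c') q * weightFact (a' + b') r
      * weightFact (a' + c') (q + a' - r) * wSum a' b' c' r (q + a' - r) ^ 2 : ℝ) : ℂ)
      * phase t (b' - c' + 2 * q + 2 * a' - 4 * r))) s₁ (a + b + 2 - s₁) (a' + b')
      (fun z hz => by rw [wSum_eq_zero (by omega)]; simp)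
      (fun z hz => by rw [wSum_eq_zero (by push_cast at hz; omega)]; simp) (by omega)
  rw [← hshift, show s₁ + (a + b + 2 - s₁) = a + b + 2 by omega]
  refine Finset.sum_congr rfl fun r _ => ?_
  have hN := (cgNormSq_pos a' b' c').ne'
  rw [hκ, ← mul_assoc, ← Complex.ofReal_mul]
  have hn' : (b' : ℤ) + c' = b + c := by omega
  rw [show (a : ℤ) + b + 1 - 2 * s₁ = a' + b' by omega,
    show (a : ℤ) + c + 1 - 2 * s₂ = a' + c' by omega,
    show (q : ℤ) + a + 1 - r - s₂ = q + a' - (r - s₁) by omega, hn']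
  congr 2
  · push_cast
    field_simp
  · omega

/-! ### The three term recurrence -/

theorem recA_eq_diagonal (n d : ℕ) : recA n d
    = Matrix.diagonal fun k => |recCoeff n (zeta n d k) (zeta n (d + 1) k)| ^ 2 :=
  Matrix.sum_single_eq_diagonal _

theorem recC_succ_eq_diagonal (n d : ℕ) : recC n (d + 1)
    = Matrix.diagonal fun k => |recCoeff n (zeta n (d + 1) k) (zeta n d k)| ^ 2 :=
  Matrix.sum_single_eq_diagonal _

theorem recB_apply (n d : ℕ) (i j : Fin (n + 1)) : recB n d i j
    = if (j : ℕ) = i + 1 ∨ (i : ℕ) = j + 1 then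
      |recCoeff n (zeta n d i) (zeta n d j)| ^ 2 else 0 := by
  rw [recB, Matrix.sum_apply, Finset.sum_eq_single i, Matrix.sum_apply, Finset.sum_eq_single j]
  · split_ifs <;> simp
  · intro k _ hk
    split_ifs
    · rw [Matrix.single_apply_of_col_ne _ _ hk]
    · rfl
  · simp
  · intro k _ hk
    rw [Matrix.sum_apply]
    refine Finset.sum_eq_zero fun l _ => ?_
    split_ifs
    · rw [Matrix.single_apply_of_row_ne hk]
    · rfl
  · simp

theorem component_eq_zero {a b c q : ℕ} {t : ℝ} {s₁ s₂ : ℕ} (h : ∀ R₁ R₂ : ℤ,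
    coupling a b c (halfFactor s₁ (a + b)) (halfFactor s₂ (a + c)) R₁ R₂ = 0) :
    component a b c q t s₁ s₂ = 0 := by
  refine Finset.sum_eq_zero fun r _ => ?_
  rw [h]
  simp

theorem component_zero_zero (a b c q : ℕ) (t : ℝ) : component a b c q t 0 0
    = ((|recCoeff (b + c) (a + b, a + c) (a + 1 + b, a + 1 + c)| ^ 2 : ℝ) : ℂ)
      * diagEntry (a + 1 + b) (a + 1 + c) (b + c) q t := by
  refine component_eq a b c (a + 1) b c q t 0 0 (a + 1) (by omega) (by omega) (by omega) (by omega)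
    (by omega) fun R₁ R₂ => ?_
  rw [coupling_zero_zero]
  simp

theorem component_zero_one (a b c q : ℕ) (t : ℝ) : component a b c q t 0 1
    = ∑ k : Fin (b + c + 1), if (k : ℕ) = b + 1 then
      ((|recCoeff (b + c) (a + b, a + c) (a + k, a + (b + c - k))| ^ 2 : ℝ) : ℂ)
        * diagEntry (a + k) (a + (b + c - k)) (b + c) q t else 0 := by
  rcases c with _ | c
  · rw [Finset.sum_eq_zero fun k _ => if_neg (by omega)]
    refine component_eq_zero fun R₁ R₂ => ?_
    rw [coupling_zero_one, wSum_eq_zero (by simp), mul_zero]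
  · rw [Finset.sum_eq_single (⟨b + 1, by omega⟩ : Fin (b + (c + 1) + 1))]
    · rw [if_pos rfl]
      dsimp only
      rw [show b + (c + 1) - (b + 1) = c by omega]
      refine component_eq a b (c + 1) a (b + 1) c q t 0 1 (b + 1) (by omega) (by omega) (by omega)
        (by omega) (by omega) fun R₁ R₂ => ?_
      rw [coupling_zero_one]
      simp
    · exact fun k _ hk => if_neg fun h => hk (Fin.ext h)
    · simp

theorem component_one_zero (a b c q : ℕ) (t : ℝ) : component a b c q t 1 0
    = ∑ k : Fin (b + c + 1), if b = (k : ℕ) + 1 then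
      ((|recCoeff (b + c) (a + b, a + c) (a + k, a + (b + c - k))| ^ 2 : ℝ) : ℂ)
        * diagEntry (a + k) (a + (b + c - k)) (b + c) q t else 0 := by
  rcases b with _ | b
  · rw [Finset.sum_eq_zero fun k _ => if_neg (by omega)]
    refine component_eq_zero fun R₁ R₂ => ?_
    rw [coupling_one_zero, wSum_eq_zero (by simp), mul_zero]
  · rw [Finset.sum_eq_single (⟨b, by omega⟩ : Fin (b + 1 + c + 1))]
    · rw [if_pos rfl]
      dsimp only
      rw [show b + 1 + c - b = c + 1 by omega]
      refine component_eq a (b + 1) c a b (c + 1) q t 1 0 (-(c + 1)) (by omega) (by omega)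
        (by omega) (by omega) (by omega) fun R₁ R₂ => ?_
      rw [coupling_one_zero]
      simp
    · exact fun k _ hk => if_neg fun h => hk (Fin.ext (by dsimp only; omega))
    · simp

/-- For degree zero the component of spins `(ℓ₁ - 1/2, ℓ₂ - 1/2)` does not contain `H^ℓ`. -/
theorem component_one_one_zero (b c q : ℕ) (t : ℝ) : component 0 b c q t 1 1 = 0 := by
  refine component_eq_zero fun R₁ R₂ => ?_
  rw [coupling_one_one, wSum_eq_zero (by simp), mul_zero]

theorem component_one_one_succ (a b c q : ℕ) (t : ℝ) : component (a + 1) b c q t 1 1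
    = ((|recCoeff (b + c) (a + 1 + b, a + 1 + c) (a + b, a + c)| ^ 2 : ℝ) : ℂ)
      * diagEntry (a + b) (a + c) (b + c) q t := by
  refine component_eq (a + 1) b c a b c q t 1 1 (a + 1 + b + c + 1) (by omega) (by omega)
    (by omega) (by omega) (by omega) fun R₁ R₂ => ?_
  rw [coupling_one_one]
  simp

/-- The three term recurrence for the full spherical functions. -/
theorem fullSpherical_recurrence (n d : ℕ) (t : ℝ) :
    zonal (torusElt t) • fullSpherical n d (torusElt t)
      = toC (recA n d) * fullSpherical n (d + 1) (torusElt t)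
        + toC (recB n d) * fullSpherical n d (torusElt t)
        + toC (recC n d) * prev (fun e => fullSpherical n e (torusElt t)) d := by
  ext p q
  obtain ⟨b, hb⟩ := p
  obtain ⟨c, rfl⟩ : ∃ c, n = b + c := ⟨n - b, by omega⟩
  have hz : ∀ e, zeta (b + c) e ⟨b, hb⟩ = (e + b, e + c) := by
    intro e; simp [zeta]
  have hΦ : ∀ e, fullSpherical (b + c) e (torusElt t) ⟨b, hb⟩ q
      = diagEntry (e + b) (e + c) (b + c) q t := by
    intro e
    rw [fullSpherical_torusElt]
    simp
  have hA : (toC (recA (b + c) d) * fullSpherical (b + c) (d + 1) (torusElt t)) ⟨b, hb⟩ q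
      = component d b c q t 0 0 := by
    rw [component_zero_zero, recA_eq_diagonal, toC, Matrix.diagonal_map Complex.ofReal_zero,
      Matrix.diagonal_mul, hz, hz, hΦ]
  have hB : (toC (recB (b + c) d) * fullSpherical (b + c) d (torusElt t)) ⟨b, hb⟩ q
      = component d b c q t 1 0 + component d b c q t 0 1 := by
    rw [component_zero_one, component_one_zero, ← Finset.sum_add_distrib, Matrix.mul_apply]
    refine Finset.sum_congr rfl fun k _ => ?_
    rw [toC, Matrix.map_apply, recB_apply, hz, fullSpherical_torusElt, zeta]
    dsimp only
    by_cases h1 : (k : ℕ) = b + 1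
    · rw [if_pos (Or.inl h1), if_pos h1, if_neg (by omega), zero_add]
    · by_cases h2 : b = (k : ℕ) + 1
      · rw [if_pos (Or.inr h2), if_pos h2, if_neg h1, add_zero]
      · rw [if_neg (by omega), if_neg h1, if_neg h2, Complex.ofReal_zero, zero_mul, add_zero]
  have hC : (toC (recC (b + c) d) * prev (fun e => fullSpherical (b + c) e (torusElt t)) d)
      ⟨b, hb⟩ q = component d b c q t 1 1 := by
    cases d with
    | zero => rw [component_one_one_zero, prev, mul_zero, Matrix.zero_apply]
    | succ d =>
      rw [component_one_one_succ, recC_succ_eq_diagonal, toC,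
        Matrix.diagonal_map Complex.ofReal_zero, Matrix.diagonal_mul, hz, hz, prev, hΦ]
  rw [Matrix.add_apply, Matrix.add_apply, hA, hB, hC, Matrix.smul_apply, hΦ, zonal_torusElt,
    smul_eq_mul, cos_mul_diagEntry]
  ring

theorem isUnit_recA (n d : ℕ) : IsUnit (recA n d) := by
  rw [recA_eq_diagonal, Matrix.isUnit_diagonal, Pi.isUnit_iff]
  rintro ⟨b, hb⟩
  obtain ⟨c, rfl⟩ : ∃ c, n = b + c := ⟨n - b, by omega⟩
  have hz : ∀ e, zeta (b + c) e ⟨b, hb⟩ = (e + b, e + c) := by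
    intro e; simp [zeta]
  have h1 := isHalfCG_succ (d + b)
  have h2 := isHalfCG_succ (d + c)
  rw [Nat.cast_add] at h1 h2
  rw [hz, hz, isUnit_iff_ne_zero, recCoeff_sq d b c (d + 1) b c (d + 1 + b) (d + 1 + c)
    (0 : ℕ) (0 : ℕ) (halfFactor 0 (d + b)) (halfFactor 0 (d + c)) (d + 1)
    (by rwa [show d + 1 + b = d + b + 1 by ring]) (by rwa [show d + 1 + c = d + c + 1 by ring])
    rfl rfl rfl (by push_cast; ring)
    (fun R₁ R₂ => by rw [coupling_zero_zero]; simp)]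
  have := cgNormSq_pos d b c
  have := cgNormSq_pos (d + 1) b c
  positivity

/-! ### Invertibility of the spherical function of degree zero -/

/-- The case `ℓ = ℓ₁ + ℓ₂`, where the squared Clebsch–Gordan coefficients are hypergeometric
probabilities. -/
theorem clebschGordan_zero_sq (b c i₁ i₂ i : ℕ) (h₁ : i₁ ≤ b) (h₂ : i₂ ≤ c) :
    clebschGordan b c (b + c) i₁ i₂ i ^ 2 = if i₁ + i₂ = i then
      (b.choose i₁ : ℝ) * c.choose i₂ / (b + c).choose i else 0 := by
  have h := clebschGordan_sq 0 b c i₁ i₂ i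
  simp only [zero_add, add_zero] at h
  rw [h]
  split_ifs with hi
  · obtain ⟨k₁, rfl⟩ := Nat.exists_eq_add_of_le h₁
    obtain ⟨k₂, rfl⟩ := Nat.exists_eq_add_of_le h₂
    subst hi
    have hS : wSum (0 : ℕ) (i₁ + k₁ : ℕ) (i₂ + k₂ : ℕ) i₁ i₂
        = ((i₁.factorial : ℝ) * k₁.factorial * (i₂.factorial * k₂.factorial))⁻¹ := by
      have h0 : invFact 0 = 1 := by simp [invFact]
      simp [wSum, wTerm, h0, invFact_natCast]
      ring
    have e₀ := weightFact_natCast (show i₁ + i₂ + (k₁ + k₂) = i₁ + k₁ + (i₂ + k₂) by ring)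
    have e₁ := weightFact_natCast (show i₁ + k₁ = i₁ + k₁ from rfl)
    have e₂ := weightFact_natCast (show i₂ + k₂ = i₂ + k₂ from rfl)
    rw [Nat.cast_add (i₁ + k₁) (i₂ + k₂)] at e₀
    rw [Nat.cast_zero] at hS
    simp only [Nat.cast_zero, zero_add] at hS ⊢
    rw [hS, e₀, e₁, e₂, Nat.cast_add_choose, Nat.cast_add_choose,
      show i₁ + k₁ + (i₂ + k₂) = i₁ + i₂ + (k₁ + k₂) by ring, Nat.cast_add_choose, cgNormSq,
      show 0 + (i₁ + k₁) + (i₂ + k₂) + 1 = i₁ + i₂ + (k₁ + k₂) + 1 by ring, Nat.factorial_succ,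
      show i₁ + k₁ + (i₂ + k₂) = i₁ + i₂ + (k₁ + k₂) by ring]
    push_cast
    field_simp
    simp
  · rfl

theorem phase_pow (t : ℝ) (k : ℤ) (r : ℕ) : phase t k ^ r = phase t (r * k) := by
  rw [phase, phase, ← Complex.exp_nat_mul]
  push_cast
  ring_nf

/-- The rows of `Φ₀^ℓ` are, up to a factor and the binomial weights of the columns, the
coefficients of the polynomials `(1 + e^{-it} w) ^ b (1 + e^{it} w) ^ c` with `b + c = 2ℓ`. -/
theorem sum_choose_mul_diagEntry (b c : ℕ) (t : ℝ) (w : ℂ) :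
    ∑ q : Fin (b + c + 1), ((b + c).choose q : ℂ) * w ^ (q : ℕ) * diagEntry b c (b + c) q t
      = phase t (b - c) * (1 + w * phase t (-2)) ^ b * (1 + w * phase t 2) ^ c := by
  rw [add_comm 1 (w * phase t (-2)), add_comm 1 (w * phase t 2), add_pow, add_pow, Finset.sum_range,
    Finset.sum_range, mul_assoc, Finset.sum_mul_sum, Finset.mul_sum]
  simp only [diagEntry, Finset.mul_sum]
  rw [Finset.sum_comm]
  refine Finset.sum_congr rfl fun i₁ _ => ?_
  rw [Finset.sum_comm]
  refine Finset.sum_congr rfl fun i₂ _ => ?_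
  rw [Finset.sum_eq_single (⟨i₁ + i₂, by omega⟩ : Fin (b + c + 1))]
  · dsimp only
    rw [clebschGordan_zero_sq _ _ _ _ _ (by omega) (by omega), if_pos rfl]
    have h : ((b + c).choose (i₁ + i₂) : ℂ) ≠ 0 := by
      exact_mod_cast (Nat.choose_pos (by omega)).ne'
    rw [show (b : ℤ) - 2 * (i₁ : ℕ) - (c - 2 * (i₂ : ℕ)) = (b - c) + ((i₁ : ℕ) * (-2)
      + (i₂ : ℕ) * 2) by ring, phase_add, phase_add, ← phase_pow, ← phase_pow]
    push_cast
    field_simp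
    ring
  · intro q _ hq
    rw [clebschGordan_zero_sq _ _ _ _ _ (by omega) (by omega), if_neg]
    · simp
    · exact fun h => hq (Fin.ext h.symm)
  · simp

/-- At a regular element the two linear forms `1 + e^{∓it} w` are not proportional, so their
products `(1 + e^{-it} w) ^ p (1 + e^{it} w) ^ (2ℓ - p)` are linearly independent: a relation
between them becomes a polynomial in their quotient `s`, vanishing for almost all `s`. -/
theorem isUnit_fullSpherical_zero (n : ℕ) {t : ℝ} (ht : ∀ z : ℤ, t ≠ z * Real.pi) :
    IsUnit (fullSpherical n 0 (torusElt t)) := by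
  have hne : ∀ k, phase t k ≠ 0 := fun k => Complex.exp_ne_zero _
  have hαβ : phase t 2 - phase t (-2) ≠ 0 := by
    intro h
    have h4 : phase t 4 = 1 := by
      rw [show (4 : ℤ) = 2 + 2 by norm_num, phase_add]
      nth_rewrite 1 [sub_eq_zero.mp h]
      rw [← phase_add]
      simp [phase]
    rw [phase, Complex.exp_eq_one_iff] at h4
    obtain ⟨z, hz⟩ := h4
    refine ht z ?_
    have : (t : ℂ) = (z * Real.pi : ℝ) := by
      have h2 : 2 * Complex.I ≠ 0 := mul_ne_zero two_ne_zero Complex.I_ne_zero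
      refine mul_left_cancel₀ h2 ?_
      push_cast at hz ⊢
      linear_combination hz
    exact_mod_cast this
  rw [← Matrix.vecMul_injective_iff_isUnit, ← Matrix.coe_vecMulLinear, ← LinearMap.ker_eq_bot,
    LinearMap.ker_eq_bot']
  intro v hv
  have hrow : ∀ w : ℂ, ∑ p : Fin (n + 1), v p * (phase t (2 * (p : ℕ) - n)
      * (1 + w * phase t (-2)) ^ (p : ℕ) * (1 + w * phase t 2) ^ (n - (p : ℕ))) = 0 := by
    intro w
    have h : ∀ p : Fin (n + 1), phase t (2 * (p : ℕ) - n) * (1 + w * phase t (-2)) ^ (p : ℕ)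
        * (1 + w * phase t 2) ^ (n - (p : ℕ))
        = ∑ q : Fin (n + 1), (n.choose q : ℂ) * w ^ (q : ℕ)
          * fullSpherical n 0 (torusElt t) p q := by
      rintro ⟨b, hb⟩
      obtain ⟨c, rfl⟩ : ∃ c, n = b + c := ⟨n - b, by omega⟩
      have := sum_choose_mul_diagEntry b c t w
      simp only [fullSpherical_torusElt, zero_add, Nat.add_sub_cancel_left]
      rw [this]
      congr 3
      push_cast
      ring
    simp only [h, Finset.mul_sum]
    rw [Finset.sum_comm]
    refine Finset.sum_eq_zero fun q _ => ?_
    have hq : ∑ p, v p * fullSpherical n 0 (torusElt t) p q = 0 := congrFun hv q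
    calc _ = (n.choose q : ℂ) * w ^ (q : ℕ) * ∑ p, v p * fullSpherical n 0 (torusElt t) p q := by
          rw [Finset.mul_sum]
          exact Finset.sum_congr rfl fun p _ => by ring
      _ = 0 := by rw [hq, mul_zero]
  set P : Polynomial ℂ := ∑ p : Fin (n + 1),
    Polynomial.C (v p * phase t (2 * (p : ℕ) - n)) * Polynomial.X ^ (p : ℕ) with hP
  have hP0 : P = 0 := by
    refine Polynomial.eq_zero_of_infinite_isRoot P
      ((Set.finite_singleton (phase t (-2) / phase t 2)).infinite_compl.mono fun s hs => ?_)
    have hs' : s * phase t 2 - phase t (-2) ≠ 0 := by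
      intro h
      exact hs (by rw [Set.mem_singleton_iff, eq_div_iff (hne 2)]; linear_combination h)
    -- the parameter `w` at which `1 + e^{-it} w = s (1 + e^{it} w)`
    have hw := hrow ((1 - s) / (s * phase t 2 - phase t (-2)))
    set u : ℂ := (phase t 2 - phase t (-2)) / (s * phase t 2 - phase t (-2)) with hu
    have h1 : 1 + (1 - s) / (s * phase t 2 - phase t (-2)) * phase t 2 = u := by
      rw [hu]; field_simp; ring
    have h2 : 1 + (1 - s) / (s * phase t 2 - phase t (-2)) * phase t (-2) = s * u := by
      rw [hu]; field_simp; ring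
    rw [h1, h2] at hw
    have hu0 : u ^ n ≠ 0 := pow_ne_zero _ (div_ne_zero hαβ hs')
    refine (mul_eq_zero.mp (?_ : u ^ n * P.eval s = 0)).resolve_left hu0
    rw [← hw, hP, Polynomial.eval_finsetSum, Finset.mul_sum]
    refine Finset.sum_congr rfl fun p _ => ?_
    have : u ^ n = u ^ (p : ℕ) * u ^ (n - (p : ℕ)) := by
      rw [← pow_add, Nat.add_sub_cancel' (by omega)]
    simp only [Polynomial.eval_mul, Polynomial.eval_C, Polynomial.eval_pow, Polynomial.eval_X]
    rw [this, mul_pow]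
    ring
  funext p
  have hc := congrArg (fun f : Polynomial ℂ => f.coeff p) hP0
  simp only [hP, Polynomial.finsetSum_coeff, Polynomial.coeff_C_mul, Polynomial.coeff_X_pow,
    Polynomial.coeff_zero] at hc
  rw [Finset.sum_eq_single p] at hc
  · simpa [hne] using hc
  · intro j _ hj
    rw [if_neg (fun h => hj (Fin.ext h.symm)), mul_zero]
  · simp

/-! ### The matrix polynomials -/

/-- Multiplying by a real matrix that has been inverted over `ℝ`. -/
theorem toC_mul_toC_inv {n : ℕ} {M : Matrix (Fin (n + 1)) (Fin (n + 1)) ℝ} (h : IsUnit M) :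
    toC M * toC M⁻¹ = 1 ∧ toC M⁻¹ * toC M = 1 := by
  rw [Matrix.isUnit_iff_isUnit_det] at h
  have hmul : ∀ A B : Matrix (Fin (n + 1)) (Fin (n + 1)) ℝ, toC A * toC B = toC (A * B) :=
    fun A B => (map_mul Complex.ofRealHom.mapMatrix A B).symm
  have hone : toC (1 : Matrix (Fin (n + 1)) (Fin (n + 1)) ℝ) = 1 :=
    map_one Complex.ofRealHom.mapMatrix
  rw [hmul, hmul, Matrix.mul_nonsing_inv _ h, Matrix.nonsing_inv_mul _ h, hone]
  exact ⟨rfl, rfl⟩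

/-- A constant matrix as a matrix polynomial. -/
def constPoly {n : ℕ} (M : Matrix (Fin (n + 1)) (Fin (n + 1)) ℂ) :
    Matrix (Fin (n + 1)) (Fin (n + 1)) (Polynomial ℂ) := M.map Polynomial.C

/-- The matrix polynomials generated by the three term recurrence from `P₀ = 1`. -/
def matrixPoly (n : ℕ) : ℕ → Matrix (Fin (n + 1)) (Fin (n + 1)) (Polynomial ℂ)
  | 0 => 1
  | 1 => constPoly (toC (recA n 0)⁻¹) * ((Polynomial.X : Polynomial ℂ) • 1
      - constPoly (toC (recB n 0)) * 1)
  | d + 2 => constPoly (toC (recA n (d + 1))⁻¹) * ((Polynomial.X : Polynomial ℂ)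
      • matrixPoly n (d + 1) - constPoly (toC (recB n (d + 1))) * matrixPoly n (d + 1)
      - constPoly (toC (recC n (d + 1))) * matrixPoly n d)

theorem matrixPoly_eval_recurrence (n d : ℕ) (z : ℂ) :
    z • (matrixPoly n d).map (Polynomial.eval z)
      = toC (recA n d) * (matrixPoly n (d + 1)).map (Polynomial.eval z)
        + toC (recB n d) * (matrixPoly n d).map (Polynomial.eval z)
        + toC (recC n d) * prev (fun e => (matrixPoly n e).map (Polynomial.eval z)) d := by
  have hmap : ∀ M : Matrix (Fin (n + 1)) (Fin (n + 1)) (Polynomial ℂ),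
      M.map (Polynomial.eval z) = (Polynomial.evalRingHom z).mapMatrix M := fun _ => rfl
  have hconst : ∀ M : Matrix (Fin (n + 1)) (Fin (n + 1)) ℂ,
      (Polynomial.evalRingHom z).mapMatrix (constPoly M) = M := by
    intro M; ext i j; simp [constPoly]
  have hX : ∀ M : Matrix (Fin (n + 1)) (Fin (n + 1)) (Polynomial ℂ),
      (Polynomial.evalRingHom z).mapMatrix ((Polynomial.X : Polynomial ℂ) • M)
        = z • (Polynomial.evalRingHom z).mapMatrix M := by
    intro M; ext i j; simp
  have hinv := (toC_mul_toC_inv (isUnit_recA n d)).1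
  cases d with
  | zero =>
    simp only [hmap, prev, matrixPoly, map_mul, map_sub, hX, hconst]
    rw [← mul_assoc, hinv, one_mul, mul_zero]
    abel
  | succ d =>
    simp only [hmap, prev]
    rw [matrixPoly]
    simp only [map_mul, map_sub, hX, hconst]
    rw [← mul_assoc, hinv, one_mul]
    abel

/-- A three term recurrence with invertible leading coefficients determines its solution. -/
theorem eq_of_recurrence {n : ℕ} {z : ℂ} {F G : ℕ → Matrix (Fin (n + 1)) (Fin (n + 1)) ℂ}
    (h0 : F 0 = G 0)
    (hF : ∀ d, z • F d = toC (recA n d) * F (d + 1) + toC (recB n d) * F d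
      + toC (recC n d) * prev F d)
    (hG : ∀ d, z • G d = toC (recA n d) * G (d + 1) + toC (recB n d) * G d
      + toC (recC n d) * prev G d) (d : ℕ) : F d = G d := by
  have key : ∀ d, F d = G d ∧ prev F d = prev G d := by
    intro d
    induction d with
    | zero => exact ⟨h0, rfl⟩
    | succ d ih =>
      refine ⟨?_, ih.1⟩
      have h : toC (recA n d) * F (d + 1) = toC (recA n d) * G (d + 1) := by
        have h1 := hF d
        rw [ih.1, ih.2, hG d] at h1
        exact (add_right_cancel (add_right_cancel h1)).symm
      have h2 := congrArg (toC (recA n d)⁻¹ * ·) h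
      simpa only [← mul_assoc, (toC_mul_toC_inv (isUnit_recA n d)).2, one_mul] using h2
  exact (key d).1

theorem fullSphericalPoly_recurrence (n d : ℕ) (t : ℝ) :
    zonal (torusElt t) • fullSphericalPoly n d (torusElt t)
      = toC (recA n d) * fullSphericalPoly n (d + 1) (torusElt t)
        + toC (recB n d) * fullSphericalPoly n d (torusElt t)
        + toC (recC n d) * prev (fun e => fullSphericalPoly n e (torusElt t)) d := by
  have hprev : prev (fun e => fullSphericalPoly n e (torusElt t)) d
      = prev (fun e => fullSpherical n e (torusElt t)) d
        * (fullSpherical n 0 (torusElt t))⁻¹ := by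
    cases d with
    | zero => exact (zero_mul _).symm
    | succ d => rfl
  rw [hprev]
  simp only [fullSphericalPoly]
  rw [← smul_mul_assoc, fullSpherical_recurrence]
  simp only [add_mul, mul_assoc]

end SU2

end

theorem theorem4 (n : ℕ) :
    (∀ a ∈ SU2.Astar, ∀ d : ℕ,
      SU2.zonal a • SU2.fullSpherical n d a
        = SU2.toC (SU2.recA n d) * SU2.fullSpherical n (d + 1) a
          + SU2.toC (SU2.recB n d) * SU2.fullSpherical n d a
          + SU2.toC (SU2.recC n d) * SU2.prev (fun e => SU2.fullSpherical n e a) d) ∧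
    (∀ a ∈ SU2.AstarReg, IsUnit (SU2.fullSpherical n 0 a) ∧ ∀ d : ℕ,
      SU2.zonal a • SU2.fullSphericalPoly n d a
        = SU2.toC (SU2.recA n d) * SU2.fullSphericalPoly n (d + 1) a
          + SU2.toC (SU2.recB n d) * SU2.fullSphericalPoly n d a
          + SU2.toC (SU2.recC n d) * SU2.prev (fun e => SU2.fullSphericalPoly n e a) d) ∧
    (∃ P : ℕ → Matrix (Fin (n + 1)) (Fin (n + 1)) (Polynomial ℂ),
      (∀ a ∈ SU2.AstarReg, ∀ d : ℕ,
        SU2.fullSphericalPoly n d a = (P d).map (Polynomial.eval (SU2.zonal a))) ∧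
      ∀ a ∈ SU2.Astar, ∀ d : ℕ,
        SU2.zonal a • (P d).map (Polynomial.eval (SU2.zonal a))
          = SU2.toC (SU2.recA n d) * (P (d + 1)).map (Polynomial.eval (SU2.zonal a))
            + SU2.toC (SU2.recB n d) * (P d).map (Polynomial.eval (SU2.zonal a))
            + SU2.toC (SU2.recC n d)
              * SU2.prev (fun e => (P e).map (Polynomial.eval (SU2.zonal a))) d) ∧
    (∀ d : ℕ, IsUnit (SU2.recA n d)) := by
  refine ⟨?_, ?_, ⟨SU2.matrixPoly n, ?_, ?_⟩, SU2.isUnit_recA n⟩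
  · rintro _ ⟨t, -, -, rfl⟩ d
    exact SU2.fullSpherical_recurrence n d t
  · rintro _ ⟨t, -, -, ht, rfl⟩
    exact ⟨SU2.isUnit_fullSpherical_zero n ht, fun d => SU2.fullSphericalPoly_recurrence n d t⟩
  · rintro _ ⟨t, -, -, ht, rfl⟩ d
    refine SU2.eq_of_recurrence (F := fun d => SU2.fullSphericalPoly n d (SU2.torusElt t)) ?_
      (fun d => SU2.fullSphericalPoly_recurrence n d t)
      (fun d => SU2.matrixPoly_eval_recurrence n d (SU2.zonal (SU2.torusElt t))) d
    have h := (Matrix.isUnit_iff_isUnit_det _).mp (SU2.isUnit_fullSpherical_zero n ht)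
    change SU2.fullSpherical n 0 _ * (SU2.fullSpherical n 0 _)⁻¹ = _
    rw [Matrix.mul_nonsing_inv _ h, SU2.matrixPoly]
    exact (map_one (Polynomial.evalRingHom _).mapMatrix).symm
  · intro a _ d
    exact SU2.matrixPoly_eval_recurrence n d (SU2.zonal a)
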